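/- Let $\xi$ be the entire function that extends $\frac{s(s-1)}{2}\pi^{-s/2}\Gamma(s/2)\zeta(s)$, and put $\Xi(t)=\xi(\tfrac12+it)$ for $t\in\mathbb{C}$. Let $\gamma$ be Euler's constant and $G=\sum_{n=0}^\infty \frac{(-1)^n}{(2n+1)^2}$ Catalan's constant. Then $\zeta(\tfrac12)\neq 0$ and $$\frac{\zeta'(\frac12)}{\zeta(\frac12)}=\frac{\pi}{4}+\frac{\gamma}{2}+\frac{\log(8\pi)}{2}.$$ Moreover, the zeros of $\Xi$ with positive real part can be arranged in an infinite sequence $(\alpha_n)_{n\ge 1}$ with $0<\operatorname{Re}\alpha_1\le\operatorname{Re}\alpha_2\le\cdots$, each zero being repeated according to its multiplicity; and for every such sequence the series $\sum_{n=1}^\infty \alpha_n^{-2}$ converges absolutely and $$\frac{\zeta''(\frac12)}{\zeta(\frac12)}-\Bigl(\frac{\zeta'(\frac12)}{\zeta(\frac12)}\Bigr)^2=8-\frac{\pi^2}{4}-2G+2\sum_{n=1}^\infty\frac{1}{\alpha_n^2}.$$ The Riemann hypothesis is not assumed. -/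

import Mathlib

/-- The Riemann xi function, as an entire function. Since Mathlib's entire function
`completedRiemannZeta₀` equals `π^(-s/2) Γ(s/2) ζ(s) + 1/s + 1/(1-s)` away from the poles, this is the
entire extension of `s (s-1) / 2 * π^(-s/2) Γ(s/2) ζ(s)`; see `xi_eq`, `differentiable_xi`. -/
noncomputable def xi (s : ℂ) : ℂ :=
  (s * (s - 1) * completedRiemannZeta₀ s + 1) / 2

theorem differentiable_xi : Differentiable ℂ xi := by
  unfold xi
  have := differentiable_completedZeta₀
  fun_prop

/-- `xi` is given by the classical formula wherever the latter has no removable singularity. -/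
theorem xi_eq (s : ℂ) (h1 : s ≠ 1) (hG : ∀ n : ℕ, s ≠ -(2 * (n : ℂ))) :
    xi s = s * (s - 1) / 2 * (Real.pi : ℂ) ^ (-s / 2) * Complex.Gamma (s / 2) * riemannZeta s := by
  have h0 : s ≠ 0 := by simpa using hG 0
  have hΓ : Complex.Gamma (s / 2) ≠ 0 := by
    refine Complex.Gamma_ne_zero fun m hm => hG m ?_
    linear_combination 2 * hm
  have hπ : (Real.pi : ℂ) ^ (-s / 2) ≠ 0 := by
    simp [Complex.cpow_eq_zero_iff, Real.pi_ne_zero]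
  have h1' : (1 : ℂ) - s ≠ 0 := sub_ne_zero.mpr h1.symm
  rw [riemannZeta_def_of_ne_zero h0, Complex.Gammaℝ_def, completedRiemannZeta_eq, xi]
  field_simp
  ring

/-- `Ξ(t) = ξ(1/2 + i t)`. -/
noncomputable def Xi (t : ℂ) : ℂ := xi (1 / 2 + Complex.I * t)

/-- `α 0, α 1, …` lists the zeros of `Ξ` with positive real part, by nondecreasing real part, each
zero repeated according to its multiplicity (a point that is not a zero has order `0` and is
therefore not listed). -/
structure IsXiZeroSequence (α : ℕ → ℂ) : Prop where
  re_pos : ∀ n, 0 < (α n).re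
  monotone_re : Monotone fun n => (α n).re
  multiplicity : ∀ z : ℂ, 0 < z.re → {n : ℕ | α n = z}.encard = analyticOrderAt Xi z

/-- Catalan's constant `1 - 1/3² + 1/5² - ⋯`. -/
noncomputable def catalanConstant : ℝ := ∑' n : ℕ, (-1 : ℝ) ^ n / (2 * (n : ℝ) + 1) ^ 2

/-! Both identities come from logarithmic derivatives of `xi` at 1/2, computed in two ways. The
product formula for `xi` gives ζ'/ζ and its derivative at 1/2 plus elementary terms and the values
of ψ and ψ' at 1/4 (`logDeriv_and_deriv_logDeriv_xi_one_half`). These values follow from the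
reflection and duplication formulas (`digamma_one_fourth`, `realTrigamma_one_fourth`). On the other
side, the functional equation makes 1/2 a critical point of `xi`, which yields the first identity.
For the second, `Xi` is entire with growth exponent below 2 (`norm_Xi_le`), so (Ξ'/Ξ)'(0) is minus
the sum of the inverse squares of all zeros (`summable_and_deriv_logDeriv_eq`). Instead of a full
Hadamard product, the zeros in a large disc are divided out and the second logarithmic derivative of
the zero-free quotient is shown to tend to 0 by Borel–Carathéodory. `Xi` is even and has no zeros on
the imaginary axis, so its zeros are the α and the -α; hence the factor 2. If there were only
finitely many zeros, Ξ(z)² = Ξ(z)Ξ(-z) would be polynomially bounded, contradicting factorial growth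
at ξ(2n) (`infinite_of_encard_eq`). -/

/-! ### Entire functions: Borel–Carathéodory and division by finitely many zeros. -/

open Complex Metric Filter Topology Set in
/-- Borel–Carathéodory estimate for the second logarithmic derivative of a zero-free function. -/
theorem norm_deriv_logDeriv_le {g : ℂ → ℂ} (hg : Differentiable ℂ g) {c : ℂ} {R A : ℝ}
    (hR : 0 < R) (hA : 0 < A) (h0 : ∀ z ∈ ball c R, g z ≠ 0)
    (hb : ∀ z ∈ ball c R, ‖g z‖ ≤ Real.exp A * ‖g c‖) :
    ‖deriv (logDeriv g) c‖ ≤ 16 * A / R ^ 2 := by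
  have hd : DifferentiableOn ℂ (logDeriv g) (ball c R) := by
    have : DifferentiableOn ℂ (fun z => deriv g z / g z) (ball c R) :=
      (hg.deriv.differentiableOn).div hg.differentiableOn h0
    exact this
  obtain ⟨L, hL⟩ := hd.isExactOn_ball
  have hc : c ∈ ball c R := mem_ball_self hR
  -- `g = g c * exp (L - L c)` on the ball
  have hexp : ∀ z ∈ ball c R, g z = g c * exp (L z - L c) := by
    have hder : ∀ z ∈ ball c R, HasDerivAt (fun z => g z * exp (-(L z - L c))) 0 z := by
      intro z hz
      have h1 := (hg z).hasDerivAt.mul (((hL z hz).sub_const (L c)).neg.cexp)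
      convert! h1 using 1
      rw [logDeriv_apply]
      field_simp [h0 z hz]
      ring
    intro z hz
    have := (convex_ball c R).is_const_of_fderivWithin_eq_zero (𝕜 := ℂ)
      (f := fun z => g z * exp (-(L z - L c)))
      (fun w hw => (hder w hw).differentiableAt.differentiableWithinAt)
      (fun w hw => by
        rw [fderivWithin_of_isOpen isOpen_ball hw]
        rw [(hder w hw).hasFDerivAt.fderiv]
        simp) hz hc
    simp only [sub_self, neg_zero, exp_zero, mul_one] at this
    rw [← this, mul_assoc, ← exp_add]
    simp
  set h : ℂ → ℂ := fun w => L (c + w) - L c with hh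
  have hmem : ∀ w ∈ ball (0 : ℂ) R, c + w ∈ ball c R := by
    intro w hw; simpa [mem_ball_iff_norm] using hw
  have hhd : ∀ w ∈ ball (0 : ℂ) R, HasDerivAt h (logDeriv g (c + w)) w := by
    intro w hw
    exact ((hL _ (hmem w hw)).comp_const_add c w).sub_const (L c)
  have hdiff : DifferentiableOn ℂ h (ball 0 R) := fun w hw =>
    (hhd w hw).differentiableAt.differentiableWithinAt
  have hre : MapsTo h (ball 0 R) {z | z.re ≤ A} := by
    intro w hw
    have h1 := hb _ (hmem w hw)
    rw [hexp _ (hmem w hw), norm_mul, norm_exp, mul_comm] at h1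
    have h2 : 0 < ‖g c‖ := norm_pos_iff.2 (h0 c hc)
    have h3 := le_of_mul_le_mul_right h1 h2
    exact Real.exp_le_exp.1 h3
  -- Borel–Carathéodory gives 2Ar/(R - r), which is 2A at r = R/2; Cauchy's estimate on that circle
  -- then gives 2! · 2A/(R/2)² = 16A/R².
  have hbd : ∀ w ∈ sphere (0 : ℂ) (R / 2), ‖h w‖ ≤ 2 * A := by
    intro w hw
    have hw' : ‖w‖ = R / 2 := by simpa using hw
    have hwb : w ∈ ball (0 : ℂ) R := by simp [hw', hR]
    have := borelCaratheodory_zero hA hdiff hre hR hwb (by simp [hh])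
    rw [hw'] at this
    refine this.trans_eq ?_
    field_simp
    ring
  have hsub : closedBall (0 : ℂ) (R / 2) ⊆ ball 0 R := closedBall_subset_ball (by linarith)
  have hcl : DiffContOnCl ℂ h (ball 0 (R / 2)) := by
    apply DifferentiableOn.diffContOnCl
    rw [closure_ball _ (by positivity)]
    exact hdiff.mono hsub
  have key := norm_iteratedDeriv_le_of_forall_mem_sphere_norm_le 2 (by positivity) hcl hbd
  have e : iteratedDeriv 2 h 0 = deriv (logDeriv g) c := by
    rw [iteratedDeriv_succ, iteratedDeriv_one]
    have : deriv h =ᶠ[𝓝 0] fun w => logDeriv g (c + w) := by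
      filter_upwards [isOpen_ball.mem_nhds (mem_ball_self hR)] with w hw using (hhd w hw).deriv
    rw [this.deriv_eq, deriv_comp_const_add]
    simp
  rw [e] at key
  refine key.trans_eq ?_
  simp [Nat.factorial]
  field_simp
  ring

/-- An entire function vanishing at `a ≠ 0` is divisible by `1 - z / a`. -/
theorem exists_eq_mul_one_sub_div {f : ℂ → ℂ} (hf : Differentiable ℂ f) {a : ℂ} (ha : a ≠ 0)
    (h : f a = 0) : ∃ g : ℂ → ℂ, Differentiable ℂ g ∧ ∀ z, f z = g z * (1 - z / a) := by
  refine ⟨fun z => -a * dslope f a z, ?_, fun z => ?_⟩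
  · have : Differentiable ℂ (dslope f a) := by
      rw [← differentiableOn_univ] at hf ⊢
      exact (Complex.differentiableOn_dslope Filter.univ_mem).2 hf
    exact this.const_mul _
  · have := sub_smul_dslope f a z
    rw [h, sub_zero, smul_eq_mul] at this
    rw [← this]
    field_simp
    ring

theorem analyticOrderAt_one_sub_div {a : ℂ} (ha : a ≠ 0) (w : ℂ) :
    analyticOrderAt (fun z : ℂ => 1 - z / a) w = if a = w then 1 else 0 := by
  split_ifs with h
  · subst h
    refine AnalyticAt.analyticOrderAt_eq_one_of_zero_deriv_ne_zero (by fun_prop) (by simp [ha]) ?_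
    simp [ha]
  · refine analyticOrderAt_eq_zero.2 (Or.inr ?_)
    rw [sub_ne_zero]
    intro h'
    rw [eq_div_iff ha] at h'
    exact h (by simpa using h')

theorem analyticOrderAt_prod_one_sub_div {ι : Type*} {β : ι → ℂ} (S : Finset ι)
    (hβ : ∀ i ∈ S, β i ≠ 0) (w : ℂ) :
    analyticOrderAt (fun z : ℂ => ∏ i ∈ S, (1 - z / β i)) w
      = ((S.filter (fun i => β i = w)).card : ℕ∞) := by
  classical
  induction S using Finset.induction_on with
  | empty => simp [analyticOrderAt_eq_zero]
  | insert a S ha ih =>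
    have e : (fun z : ℂ => ∏ i ∈ insert a S, (1 - z / β i))
        = (fun z : ℂ => 1 - z / β a) * fun z => ∏ i ∈ S, (1 - z / β i) := by
      ext z; simp [Finset.prod_insert ha]
    rw [e, analyticOrderAt_mul (by fun_prop)
      (Differentiable.analyticAt (by fun_prop) w),
      ih (fun i hi => hβ i (Finset.mem_insert_of_mem hi)),
      analyticOrderAt_one_sub_div (hβ a (Finset.mem_insert_self _ _)), Finset.filter_insert]
    split_ifs with h
    · rw [Finset.card_insert_of_notMem (by simp [ha])]
      push_cast; ring
    · simp

/-- Finitely many zeros of an entire function, counted with multiplicity, can be divided out. -/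
theorem exists_eq_mul_prod {ι : Type*} {β : ι → ℂ} {f : ℂ → ℂ} (hf : Differentiable ℂ f)
    (S : Finset ι) (hβ : ∀ i ∈ S, β i ≠ 0)
    (hS : ∀ w, ((S.filter (fun i => β i = w)).card : ℕ∞) ≤ analyticOrderAt f w) :
    ∃ g : ℂ → ℂ, Differentiable ℂ g ∧ (∀ z, f z = g z * ∏ i ∈ S, (1 - z / β i)) ∧
      ∀ w, analyticOrderAt f w
        = analyticOrderAt g w + ((S.filter (fun i => β i = w)).card : ℕ∞) := by
  classical
  suffices H : ∃ g : ℂ → ℂ, Differentiable ℂ g ∧ (∀ z, f z = g z * ∏ i ∈ S, (1 - z / β i)) by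
    obtain ⟨g, hg, hfg⟩ := H
    refine ⟨g, hg, hfg, fun w => ?_⟩
    rw [← analyticOrderAt_prod_one_sub_div S hβ w, ← analyticOrderAt_mul (hg.analyticAt w)
      (Differentiable.analyticAt (by fun_prop) w)]
    congr 1
    ext z; simp [hfg z]
  induction S using Finset.induction_on with
  | empty => exact ⟨f, hf, by simp⟩
  | insert a S ha ih =>
    obtain ⟨g, hg, hfg⟩ := ih (fun i hi => hβ i (Finset.mem_insert_of_mem hi)) (fun w =>
      le_trans (by gcongr; exact Finset.subset_insert _ _) (hS w))
    have ho : analyticOrderAt f (β a) = analyticOrderAt g (β a)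
        + ((S.filter (fun i => β i = β a)).card : ℕ∞) := by
      rw [← analyticOrderAt_prod_one_sub_div S (fun i hi => hβ i (Finset.mem_insert_of_mem hi)),
        ← analyticOrderAt_mul (hg.analyticAt _) (Differentiable.analyticAt (by fun_prop) _)]
      congr 1
      ext z; simp [hfg z]
    -- Otherwise the order of `f` at `β a` would be the number of indices in `S` over that point,
    -- one too few for `insert a S`.
    have hga : g (β a) = 0 := by
      apply apply_eq_zero_of_analyticOrderAt_ne_zero
      intro h0
      have := hS (β a)
      rw [ho, h0, zero_add, Finset.filter_insert, if_pos rfl,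
        Finset.card_insert_of_notMem (by simp [ha])] at this
      norm_cast at this
      omega
    obtain ⟨k, hk, hgk⟩ := exists_eq_mul_one_sub_div hg (hβ a (Finset.mem_insert_self _ _)) hga
    refine ⟨k, hk, fun z => ?_⟩
    rw [hfg, hgk, Finset.prod_insert ha, mul_assoc]

open Metric in
/-- Maximum principle for the quotient of an entire function by a product over zeros. -/
theorem norm_le_of_eq_mul_prod {ι : Type*} {β : ι → ℂ} {f g : ℂ → ℂ} (hg : Differentiable ℂ g)
    {S : Finset ι} (hfg : ∀ z, f z = g z * ∏ i ∈ S, (1 - z / β i)) {R ρ M : ℝ} (hR : 0 < R)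
    (hρ : 1 ≤ ρ) (hβ : ∀ i ∈ S, β i ≠ 0) (hβR : ∀ i ∈ S, ‖β i‖ ≤ R)
    (hM : ∀ z ∈ sphere (0 : ℂ) ((ρ + 1) * R), ‖f z‖ ≤ M) {z : ℂ}
    (hz : z ∈ closedBall (0 : ℂ) ((ρ + 1) * R)) : ‖g z‖ * ρ ^ S.card ≤ M := by
  have hr : 0 < (ρ + 1) * R := by positivity
  have hρ0 : 0 < ρ ^ S.card := by positivity
  rw [← le_div_iff₀ hρ0]
  refine Complex.norm_le_of_forall_mem_frontier_norm_le isBounded_ball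
    (hg.diffContOnCl) (U := ball (0 : ℂ) ((ρ + 1) * R)) ?_ ?_
  · intro w hw
    rw [frontier_ball _ hr.ne'] at hw
    have h1 := hM w hw
    rw [hfg, norm_mul, norm_prod] at h1
    rw [le_div_iff₀ hρ0]
    refine le_trans ?_ h1
    gcongr
    rw [← Finset.prod_const]
    refine Finset.prod_le_prod (fun _ _ => by positivity) fun i hi => ?_
    have hw' : ‖w‖ = (ρ + 1) * R := by simpa using hw
    -- On the circle of radius (ρ + 1)R every factor 1 - w/β has modulus at least ρ. With ρ = 2 this
    -- counts zeros; with ρ = 1 it bounds the quotient by the maximum of `f`.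
    have h2 : ρ + 1 ≤ ‖w / β i‖ := by
      rw [norm_div, hw', le_div_iff₀ (norm_pos_iff.2 (hβ i hi))]
      gcongr
      exact hβR i hi
    have h3 := norm_sub_norm_le (w / β i) 1
    rw [norm_one, norm_sub_rev] at h3
    linarith
  · rwa [closure_ball _ hr.ne']

open Filter Topology in
theorem deriv_logDeriv_mul {f g : ℂ → ℂ} {x : ℂ} (hf : AnalyticAt ℂ f x) (hg : AnalyticAt ℂ g x)
    (hfx : f x ≠ 0) (hgx : g x ≠ 0) :
    deriv (logDeriv (fun z => f z * g z)) x = deriv (logDeriv f) x + deriv (logDeriv g) x := by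
  have h : logDeriv (fun z => f z * g z) =ᶠ[𝓝 x] fun z => logDeriv f z + logDeriv g z := by
    filter_upwards [hf.continuousAt.eventually_ne hfx, hg.continuousAt.eventually_ne hgx,
      hf.eventually_analyticAt, hg.eventually_analyticAt] with z h1 h2 h3 h4
    exact logDeriv_mul z h1 h2 h3.differentiableAt h4.differentiableAt
  rw [h.deriv_eq]
  exact deriv_fun_add (hf.deriv.div hf hfx).differentiableAt
    (hg.deriv.div hg hgx).differentiableAt

theorem deriv_logDeriv_one_sub_div {a : ℂ} (ha : a ≠ 0) :
    deriv (logDeriv (fun z : ℂ => 1 - z / a)) 0 = -(1 / a ^ 2) := by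
  have e : logDeriv (fun z : ℂ => 1 - z / a) = fun z => -(1 / a) / (1 - z / a) := by
    ext z
    rw [logDeriv_apply]
    simp
  have h1 : HasDerivAt (fun z : ℂ => 1 - z / a) (-(1 / a)) 0 := by
    simpa using ((hasDerivAt_id (0 : ℂ)).div_const a).const_sub 1
  have h2 := (hasDerivAt_const (0 : ℂ) (-(1 / a))).div h1 (by simp)
  rw [e]
  refine h2.deriv.trans ?_
  simp
  field_simp

theorem deriv_logDeriv_mul_prod {ι : Type*} {β : ι → ℂ} {g : ℂ → ℂ} (hg : Differentiable ℂ g)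
    (hg0 : g 0 ≠ 0) (S : Finset ι) (hβ : ∀ i ∈ S, β i ≠ 0) :
    deriv (logDeriv (fun z => g z * ∏ i ∈ S, (1 - z / β i))) 0
      = deriv (logDeriv g) 0 - ∑ i ∈ S, 1 / β i ^ 2 := by
  classical
  induction S using Finset.induction_on with
  | empty => simp
  | insert a S ha ih =>
    have e : (fun z => g z * ∏ i ∈ insert a S, (1 - z / β i))
        = fun z => (g z * ∏ i ∈ S, (1 - z / β i)) * (1 - z / β a) := by
      ext z; rw [Finset.prod_insert ha]; ring
    rw [e, deriv_logDeriv_mul (f := fun z => g z * ∏ i ∈ S, (1 - z / β i))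
      (Differentiable.analyticAt (by fun_prop) 0)
      (by fun_prop) (by simpa using hg0) (by simp),
      ih (fun i hi => hβ i (Finset.mem_insert_of_mem hi)),
      deriv_logDeriv_one_sub_div (hβ a (Finset.mem_insert_self _ _)), Finset.sum_insert ha]
    ring

-- This is the Borel–Carathéodory bound on a disc of radius n + 1, with the maximum taken on the
-- circle of radius 2(n + 1). The growth condition p < 2 is what makes it vanish in the limit.
open Filter Topology in
theorem tendsto_growth_div_sq {C K p : ℝ} (hC : 0 ≤ C) (hK : 0 ≤ K) (hp : 0 ≤ p) (hp2 : p < 2) :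
    Tendsto (fun n : ℕ => 16 * (C * (1 + 2 * ((n : ℝ) + 1)) ^ p + K) / ((n : ℝ) + 1) ^ 2)
      atTop (𝓝 0) := by
  have hb : Tendsto (fun n : ℕ => 16 * (C * 3 ^ p + K) * ((n : ℝ) + 1) ^ (-(2 - p))) atTop
      (𝓝 0) := by
    have h1 := (tendsto_rpow_neg_atTop (by linarith : 0 < 2 - p)).comp
      (tendsto_atTop_add_const_right atTop (1 : ℝ) (tendsto_natCast_atTop_atTop (R := ℝ)))
    simpa [Function.comp_def] using h1.const_mul (16 * (C * 3 ^ p + K))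
  refine squeeze_zero (fun n => by positivity) (fun n => ?_) hb
  have hn : (1 : ℝ) ≤ (n : ℝ) + 1 := by linarith [Nat.cast_nonneg (α := ℝ) n]
  have h4 : (1 + 2 * ((n : ℝ) + 1)) ^ p ≤ 3 ^ p * ((n : ℝ) + 1) ^ p := by
    rw [← Real.mul_rpow (by norm_num) (by positivity)]
    apply Real.rpow_le_rpow (by positivity) (by linarith) hp
  have h5 : 1 ≤ ((n : ℝ) + 1) ^ p := Real.one_le_rpow hn hp
  have h6 : C * (1 + 2 * ((n : ℝ) + 1)) ^ p ≤ C * (3 ^ p * ((n : ℝ) + 1) ^ p) := by gcongr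
  have h7 : K ≤ K * ((n : ℝ) + 1) ^ p := le_mul_of_one_le_right hK h5
  rw [neg_sub, Real.rpow_sub (by positivity), Real.rpow_two, ← mul_div_assoc]
  refine div_le_div_of_nonneg_right ?_ (by positivity)
  linarith

/-! ### Zero counting and the sum of inverse squares for growth exponent below 2. -/

section Zeros

variable {ι : Type*} {β : ι → ℂ} {f : ℂ → ℂ} {C p : ℝ}

theorem ne_zero_of_encard_eq (hf0 : f 0 ≠ 0)
    (hβ : ∀ w, {i | β i = w}.encard = analyticOrderAt f w) (i : ι) : β i ≠ 0 := by
  intro h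
  have h1 : analyticOrderAt f 0 = 0 := analyticOrderAt_eq_zero.2 (Or.inr hf0)
  have h2 := hβ 0
  rw [h1, Set.encard_eq_zero] at h2
  exact Set.notMem_empty i (h2 ▸ h)

theorem card_filter_le_order (hβ : ∀ w, {i | β i = w}.encard = analyticOrderAt f w)
    (S : Finset ι) (w : ℂ) :
    ((S.filter (fun i => β i = w)).card : ℕ∞) ≤ analyticOrderAt f w := by
  rw [← hβ w, ← Set.encard_coe_eq_coe_finsetCard]
  apply Set.encard_le_encard
  intro i hi
  simpa using (Finset.mem_filter.1 (Finset.mem_coe.1 hi)).2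

/-- When `S` contains every index over `w`, its count already equals the order of `f`; the count is
finite, so it cancels in `ℕ∞` and leaves order 0 for `g`. -/
theorem ne_zero_of_order_eq_add_card (hβ : ∀ w, {i | β i = w}.encard = analyticOrderAt f w)
    {g : ℂ → ℂ} {S : Finset ι} {w : ℂ} (hg : AnalyticAt ℂ g w) (hS : ∀ i, β i = w → i ∈ S)
    (h : analyticOrderAt f w
      = analyticOrderAt g w + ((S.filter (fun i => β i = w)).card : ℕ∞)) : g w ≠ 0 := by
  have h4 : {i | β i = w} = (S.filter (fun i => β i = w) : Finset ι) := by
    ext i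
    simp only [Set.mem_ofPred_eq, Finset.coe_filter]
    exact ⟨fun h => ⟨hS i h, h⟩, fun h => h.2⟩
  rw [← hβ w, h4, Set.encard_coe_eq_coe_finsetCard] at h
  have h5 : (0 : ℕ∞) + (S.filter (fun i => β i = w)).card
      = analyticOrderAt g w + (S.filter (fun i => β i = w)).card := by rw [zero_add]; exact h
  exact hg.analyticOrderAt_eq_zero.1
    (ENat.add_left_injective_of_ne_top (ENat.natCast_ne_top _) h5).symm

/-- Zero counting: an entire function of order at most `p` has `O(R ^ p)` zeros of norm at most
`R`. -/
theorem exists_card_le (hf : Differentiable ℂ f) (hf0 : f 0 ≠ 0)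
    (hβ : ∀ w, {i | β i = w}.encard = analyticOrderAt f w) (hC : 0 ≤ C) (hp : 0 ≤ p)
    (hgr : ∀ z, ‖f z‖ ≤ Real.exp (C * (1 + ‖z‖) ^ p)) :
    ∃ D : ℝ, 0 ≤ D ∧ ∀ R : ℝ, 0 < R → ∀ S : Finset ι, (∀ i ∈ S, ‖β i‖ ≤ R) →
      (S.card : ℝ) ≤ D * (1 + R) ^ p := by
  -- A Jensen-type bound: comparing with the circle of radius 3R gives ‖f 0‖ · 2^card ≤ exp(C(1 +
  -- 3R)^p), and logarithms are taken.
  refine ⟨(C * 3 ^ p + |Real.log ‖f 0‖|) / Real.log 2, by positivity, fun R hR S hS => ?_⟩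
  obtain ⟨g, hg, hfg, -⟩ := exists_eq_mul_prod hf S (fun i _ => ne_zero_of_encard_eq hf0 hβ i)
    (card_filter_le_order hβ S)
  have h1 := norm_le_of_eq_mul_prod hg hfg (ρ := 2) (M := Real.exp (C * (1 + 3 * R) ^ p)) hR
    (by norm_num) (fun i _ => ne_zero_of_encard_eq hf0 hβ i) hS (fun z hz => by
      have hz' : ‖z‖ = 3 * R := by
        have : ‖z‖ = (2 + 1) * R := by simpa using hz
        rw [this]; norm_num
      simpa [hz'] using hgr z) (z := 0) (by simp; positivity)
  have h2 : f 0 = g 0 := by simpa using hfg 0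
  rw [← h2] at h1
  have hpos : 0 < ‖f 0‖ := norm_pos_iff.2 hf0
  have h3 := Real.log_le_log (by positivity) h1
  rw [Real.log_mul hpos.ne' (by positivity), Real.log_pow, Real.log_exp] at h3
  have h4 : (1 + 3 * R) ^ p ≤ 3 ^ p * (1 + R) ^ p := by
    rw [← Real.mul_rpow (by norm_num) (by positivity)]
    apply Real.rpow_le_rpow (by positivity) (by linarith) hp
  have h5 : 1 ≤ (1 + R) ^ p := Real.one_le_rpow (by linarith) hp
  have h6 := neg_abs_le (Real.log ‖f 0‖)
  have h7 : |Real.log ‖f 0‖| ≤ |Real.log ‖f 0‖| * (1 + R) ^ p :=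
    le_mul_of_one_le_right (abs_nonneg _) h5
  have h8 : C * (1 + 3 * R) ^ p ≤ C * (3 ^ p * (1 + R) ^ p) := by gcongr
  rw [div_mul_eq_mul_div, le_div_iff₀ (Real.log_pos (by norm_num))]
  linarith

theorem finite_norm_le (hf : Differentiable ℂ f) (hf0 : f 0 ≠ 0)
    (hβ : ∀ w, {i | β i = w}.encard = analyticOrderAt f w) (hC : 0 ≤ C) (hp : 0 ≤ p)
    (hgr : ∀ z, ‖f z‖ ≤ Real.exp (C * (1 + ‖z‖) ^ p)) {R : ℝ} (hR : 0 < R) :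
    {i | ‖β i‖ ≤ R}.Finite := by
  obtain ⟨D, -, hD⟩ := exists_card_le hf hf0 hβ hC hp hgr
  by_contra hinf
  obtain ⟨N, hN⟩ := exists_nat_gt (D * (1 + R) ^ p)
  obtain ⟨S, hS, hc⟩ := Set.Infinite.exists_subset_card_eq hinf N
  have := hD R hR S (fun i hi => hS hi)
  rw [hc] at this
  linarith

/-- Dyadic blocks: the indices with 1 + ‖β‖ in [2^n, 2^(n+1)) number at most D · 2^(p(n+1)) and
contribute at most 4^(-n) each, a geometric series of ratio 2^p/4 < 1. The shift by 1 lets the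
blocks start at n = 0. -/
theorem summable_one_div_one_add_norm_sq (hp2 : p < 2) {D : ℝ} (hD0 : 0 ≤ D)
    (hD : ∀ R : ℝ, 0 < R → ∀ S : Finset ι, (∀ i ∈ S, ‖β i‖ ≤ R) →
      (S.card : ℝ) ≤ D * (1 + R) ^ p) :
    Summable fun i => 1 / (1 + ‖β i‖) ^ 2 := by
  classical
  have hk : ∀ i, ∃ n : ℕ, (2 : ℝ) ^ n ≤ 1 + ‖β i‖ ∧ 1 + ‖β i‖ < 2 ^ (n + 1) := fun i =>
    exists_nat_pow_near (by linarith [norm_nonneg (β i)]) (by norm_num)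
  choose k hk1 hk2 using hk
  set q : ℝ := 2 ^ p / 4 with hq
  have hq0 : 0 ≤ q := by positivity
  have hq1 : q < 1 := by
    rw [hq, div_lt_one (by norm_num)]
    calc (2 : ℝ) ^ p < 2 ^ (2 : ℝ) := Real.rpow_lt_rpow_of_exponent_lt (by norm_num) hp2
      _ = 4 := by norm_num
  have hgeo := summable_geometric_of_lt_one hq0 hq1
  refine summable_of_sum_le (c := D * 2 ^ p * ∑' n : ℕ, q ^ n) (fun i => by positivity) fun u => ?_
  calc ∑ i ∈ u, 1 / (1 + ‖β i‖) ^ 2 ≤ ∑ i ∈ u, 1 / ((2 : ℝ) ^ k i) ^ 2 := by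
        gcongr with i hi
        exact hk1 i
    _ = ∑ n ∈ u.image k, ∑ i ∈ u with k i = n, 1 / ((2 : ℝ) ^ k i) ^ 2 :=
        (Finset.sum_fiberwise_of_maps_to (fun i hi => Finset.mem_image_of_mem k hi) _).symm
    _ ≤ ∑ n ∈ u.image k, D * 2 ^ p * q ^ n := by
        refine Finset.sum_le_sum fun n _ => ?_
        have h1 : ∑ i ∈ u with k i = n, 1 / ((2 : ℝ) ^ k i) ^ 2
            = ((u.filter (fun i => k i = n)).card : ℝ) * (1 / ((2 : ℝ) ^ n) ^ 2) := by
          rw [← nsmul_eq_mul, ← Finset.sum_const]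
          refine Finset.sum_congr rfl fun i hi => ?_
          rw [(Finset.mem_filter.1 hi).2]
        have h2 : (1 : ℝ) < 2 ^ (n + 1) := one_lt_pow₀ (by norm_num) (by omega)
        have h3 := hD (2 ^ (n + 1) - 1) (by linarith) (u.filter (fun i => k i = n)) (by
          intro i hi
          have := hk2 i
          rw [(Finset.mem_filter.1 hi).2] at this
          linarith)
        rw [h1]
        have h4 : D * (1 + ((2 : ℝ) ^ (n + 1) - 1)) ^ p * (1 / ((2 : ℝ) ^ n) ^ 2)
            = D * 2 ^ p * q ^ n := by
          rw [add_sub_cancel, pow_succ, Real.mul_rpow (by positivity) (by positivity), hq, div_pow,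
            ← Real.rpow_natCast (2 ^ p) n, ← Real.rpow_mul (by norm_num), mul_comm p,
            Real.rpow_mul (by norm_num), Real.rpow_natCast, ← pow_mul, mul_comm n 2, pow_mul]
          norm_num
          ring
        rw [← h4]
        gcongr
    _ = D * 2 ^ p * ∑ n ∈ u.image k, q ^ n := by rw [Finset.mul_sum]
    _ ≤ D * 2 ^ p * ∑' n : ℕ, q ^ n := by
        gcongr
        exact hgeo.sum_le_tsum _ (fun n _ => by positivity)

open Filter Topology Metric in
/-- For an entire function of order less than two, the second logarithmic derivative at the origin
is minus the sum of the inverse squares of the zeros. -/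
theorem summable_and_deriv_logDeriv_eq (hf : Differentiable ℂ f) (hf0 : f 0 ≠ 0)
    (hβ : ∀ w, {i | β i = w}.encard = analyticOrderAt f w) (hC : 0 ≤ C) (hp : 0 ≤ p) (hp2 : p < 2)
    (hgr : ∀ z, ‖f z‖ ≤ Real.exp (C * (1 + ‖z‖) ^ p)) :
    Summable (fun i => 1 / β i ^ 2) ∧ deriv (logDeriv f) 0 = -∑' i, 1 / β i ^ 2 := by
  classical
  have hne := ne_zero_of_encard_eq hf0 hβ
  have hfin : ∀ n : ℕ, {i | ‖β i‖ ≤ (n : ℝ) + 1}.Finite := fun n =>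
    finite_norm_le hf hf0 hβ hC hp hgr (by positivity)
  have hsum : Summable (fun i => 1 / β i ^ 2) := by
    -- Outside the finitely many β of norm at most 1, one has 1 + ‖β‖ ≤ 2‖β‖, whence the factor 4.
    obtain ⟨D, hD0, hD⟩ := exists_card_le hf hf0 hβ hC hp hgr
    have h1 := (summable_one_div_one_add_norm_sq hp2 hD0 hD).mul_left 4
    refine Summable.of_norm_bounded_eventually h1 ?_
    have : {i | ‖β i‖ ≤ 1}.Finite := by simpa using hfin 0
    refine this.subset fun i hi => ?_
    by_contra hlt
    apply hi
    have hlt' : 1 < ‖β i‖ := by simpa using hlt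
    change ‖1 / β i ^ 2‖ ≤ 4 * (1 / (1 + ‖β i‖) ^ 2)
    rw [norm_div, norm_one, norm_pow, mul_one_div, div_le_div_iff₀ (by positivity) (by positivity)]
    nlinarith
  refine ⟨hsum, ?_⟩
  set S : ℕ → Finset ι := fun n => (hfin n).toFinset with hS
  have hSmem : ∀ n i, i ∈ S n ↔ ‖β i‖ ≤ (n : ℝ) + 1 := by simp [hS]
  have hSt : Tendsto S atTop atTop := by
    refine tendsto_atTop_finset_of_monotone (fun m n hmn i hi => ?_) fun i => ?_
    · rw [hSmem] at hi ⊢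
      have : (m : ℝ) ≤ n := by exact_mod_cast hmn
      linarith
    · obtain ⟨n, hn⟩ := exists_nat_ge ‖β i‖
      exact ⟨n, by rw [hSmem]; linarith⟩
  have hlim : Tendsto (fun n => ∑ i ∈ S n, 1 / β i ^ 2) atTop (𝓝 (∑' i, 1 / β i ^ 2)) :=
    hsum.hasSum.comp hSt
  -- The logarithm of ‖f 0‖ passes from the bound `exp A` on the quotient to the bound `exp A * ‖g
  -- 0‖`, as g 0 = f 0; the final 1 keeps `A n` positive.
  set A : ℕ → ℝ := fun n => C * (1 + 2 * ((n : ℝ) + 1)) ^ p + |Real.log ‖f 0‖| + 1 with hA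
  have hbound : ∀ n, ‖deriv (logDeriv f) 0 + ∑ i ∈ S n, 1 / β i ^ 2‖
      ≤ 16 * A n / ((n : ℝ) + 1) ^ 2 := by
    intro n
    obtain ⟨g, hg, hfg, hord⟩ := exists_eq_mul_prod hf (S n) (fun i _ => hne i)
      (card_filter_le_order hβ (S n))
    have hR : (0 : ℝ) < (n : ℝ) + 1 := by positivity
    have h2 : f 0 = g 0 := by simpa using hfg 0
    have hg0 : g 0 ≠ 0 := h2 ▸ hf0
    have e : deriv (logDeriv f) 0 + ∑ i ∈ S n, 1 / β i ^ 2 = deriv (logDeriv g) 0 := by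
      rw [show f = fun z => g z * ∏ i ∈ S n, (1 - z / β i) from funext hfg,
        deriv_logDeriv_mul_prod hg hg0 (S n) (fun i _ => hne i)]
      ring
    rw [e]
    refine norm_deriv_logDeriv_le hg hR (by positivity) (fun w hw => ?_) fun w hw => ?_
    · have hw' : ‖w‖ < (n : ℝ) + 1 := by simpa using hw
      refine ne_zero_of_order_eq_add_card hβ (hg.analyticAt w) (fun i hi => ?_) (hord w)
      rw [hSmem, hi]
      exact hw'.le
    · have h1 := norm_le_of_eq_mul_prod hg hfg (ρ := 1)
        (M := Real.exp (C * (1 + 2 * ((n : ℝ) + 1)) ^ p)) hR le_rfl (fun i _ => hne i)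
        (fun i hi => (hSmem n i).1 hi) (fun z hz => by
          have hz' : ‖z‖ = 2 * ((n : ℝ) + 1) := by
            have : ‖z‖ = (1 + 1) * ((n : ℝ) + 1) := by simpa using hz
            rw [this]; norm_num
          simpa [hz'] using hgr z) (z := w) (by
          have hw' : ‖w‖ < (n : ℝ) + 1 := by simpa using hw
          simp only [mem_closedBall, dist_zero_right]
          linarith)
      rw [one_pow, mul_one] at h1
      refine h1.trans ?_
      rw [← h2]
      have hpos : 0 < ‖f 0‖ := norm_pos_iff.2 hf0
      rw [← Real.exp_log hpos, ← Real.exp_add, Real.exp_le_exp]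
      simp only [hA]
      linarith [neg_abs_le (Real.log ‖f 0‖)]
  have hA0 : Tendsto (fun n : ℕ => 16 * A n / ((n : ℝ) + 1) ^ 2) atTop (𝓝 0) := by
    have := tendsto_growth_div_sq hC (K := |Real.log ‖f 0‖| + 1) (by positivity) hp hp2
    simpa only [hA, add_assoc] using this
  have hz : Tendsto (fun n => deriv (logDeriv f) 0 + ∑ i ∈ S n, 1 / β i ^ 2) atTop (𝓝 0) :=
    squeeze_zero_norm hbound hA0
  have := tendsto_nhds_unique hz (hlim.const_add (deriv (logDeriv f) 0))
  linear_combination -this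

end Zeros

/-! ### Theta kernel estimates and a bound for the completed zeta function. -/

-- The kernel minus 1 is 2 Σ exp(-π(n+1)²x). Since (n+1)² ≥ n+1, a geometric series bounds it by
-- 2/(e^u - 1) with u = πx, and e^u - 1 ≥ u^k/k!. The exponent k stays free, to be matched later to
-- the size of `s`.
open HurwitzZeta in
theorem evenKernel_zero_sub_one_bounds {x : ℝ} (hx : 0 < x) {k : ℕ} (hk : k ≠ 0) :
    0 ≤ evenKernel 0 x - 1 ∧ evenKernel 0 x - 1 ≤ 2 * k.factorial / (Real.pi * x) ^ k := by
  have h := hasSum_nat_cosKernel₀ 0 hx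
  simp only [mul_zero, zero_mul, Real.cos_zero, mul_one] at h
  rw [evenKernel_eq_cosKernel_of_zero]
  have hu : 0 < Real.pi * x := by positivity
  set u := Real.pi * x with hu'
  set r := Real.exp (-u) with hr
  have hr1 : r < 1 := by rw [hr, Real.exp_lt_one_iff]; linarith
  have hr0 : 0 < r := Real.exp_pos _
  have hg : HasSum (fun n : ℕ => 2 * r * r ^ n) (2 * r * (1 - r)⁻¹) :=
    (hasSum_geometric_of_lt_one hr0.le hr1).mul_left _
  refine ⟨h.nonneg fun n => by positivity, ?_⟩
  have h1 : cosKernel 0 x - 1 ≤ 2 * r * (1 - r)⁻¹ := by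
    refine hasSum_le (fun n => ?_) h hg
    rw [mul_assoc 2 r, ← pow_succ', hr, ← Real.exp_nat_mul]
    refine mul_le_mul_of_nonneg_left (Real.exp_le_exp.2 ?_) (by norm_num)
    have : ((n : ℝ) + 1) ≤ ((n : ℝ) + 1) ^ 2 := by nlinarith [Nat.cast_nonneg (α := ℝ) n]
    have := mul_le_mul_of_nonneg_right this hu.le
    push_cast
    simp only [hu'] at *
    linarith
  refine h1.trans ?_
  have h2 : 2 * r * (1 - r)⁻¹ = 2 / (Real.exp u - 1) := by
    rw [hr, Real.exp_neg]
    have : 1 < Real.exp u := Real.one_lt_exp_iff.2 hu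
    have h3 : Real.exp u - 1 ≠ 0 := by linarith
    have h4 : 1 - (Real.exp u)⁻¹ ≠ 0 := by
      rw [sub_ne_zero]; exact (inv_lt_one_of_one_lt₀ this).ne'
    field_simp
  have h3 : u ^ k / k.factorial ≤ Real.exp u - 1 := by
    have h4 := Real.sum_le_exp_of_nonneg hu.le (k + 1)
    rw [Finset.sum_range_succ] at h4
    have h5 : 1 ≤ ∑ i ∈ Finset.range k, u ^ i / (i.factorial : ℝ) := by
      have := Finset.single_le_sum (f := fun i : ℕ => u ^ i / (i.factorial : ℝ))
        (fun i _ => by positivity) (Finset.mem_range.2 (Nat.pos_of_ne_zero hk))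
      simpa using this
    linarith
  rw [h2, mul_div_assoc]
  have h6 : (0 : ℝ) < u ^ k / k.factorial := by positivity
  calc 2 / (Real.exp u - 1) ≤ 2 / (u ^ k / k.factorial) := by gcongr
    _ = 2 * (k.factorial / u ^ k) := by field_simp

open HurwitzZeta Set in
theorem norm_f_modif_le_of_one_lt {x : ℝ} (hx : 1 < x) {k : ℕ} (hk : k ≠ 0) :
    ‖(hurwitzEvenFEPair 0).f_modif x‖ ≤ 2 * k.factorial / Real.pi ^ k * x ^ (-(k : ℝ)) := by
  have h0 : 0 < x := by linarith
  have e : (hurwitzEvenFEPair 0).f_modif x = ((evenKernel 0 x - 1 : ℝ) : ℂ) := by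
    simp [WeakFEPair.f_modif, hx, hx.le, hurwitzEvenFEPair]
  obtain ⟨h1, h2⟩ := evenKernel_zero_sub_one_bounds h0 hk
  rw [e, Complex.norm_real, Real.norm_of_nonneg h1]
  refine h2.trans_eq ?_
  rw [Real.rpow_neg h0.le, Real.rpow_natCast, mul_pow]
  field_simp

-- The theta functional equation moves the estimate to 1/x > 1, at the cost of a factor x^(-1/2).
open HurwitzZeta Set in
theorem norm_f_modif_le_of_lt_one {x : ℝ} (h0 : 0 < x) (hx : x < 1) {k : ℕ} (hk : k ≠ 0) :
    ‖(hurwitzEvenFEPair 0).f_modif x‖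
      ≤ 2 * k.factorial / Real.pi ^ k * x ^ ((k : ℝ) - 1 / 2) := by
  have e : (hurwitzEvenFEPair 0).f_modif x
      = ((1 / x ^ (1 / 2 : ℝ) * (evenKernel 0 (1 / x) - 1) : ℝ) : ℂ) := by
    have h1 := evenKernel_functional_equation 0 x
    rw [← evenKernel_eq_cosKernel_of_zero] at h1
    simp [WeakFEPair.f_modif, hx, hx.le, h0, hurwitzEvenFEPair]
    rw [h1, Real.rpow_neg h0.le]
    push_cast
    simp
    ring
  obtain ⟨h1, h2⟩ := evenKernel_zero_sub_one_bounds (one_div_pos.2 h0) hk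
  rw [e, Complex.norm_real, Real.norm_of_nonneg (by positivity)]
  calc 1 / x ^ (1 / 2 : ℝ) * (evenKernel 0 (1 / x) - 1)
      ≤ 1 / x ^ (1 / 2 : ℝ) * (2 * k.factorial / (Real.pi * (1 / x)) ^ k) := by gcongr
    _ = _ := by
      rw [Real.rpow_sub h0, Real.rpow_natCast, mul_pow, div_pow, one_pow]
      field_simp

open HurwitzZeta Set MeasureTheory in
/-- A bound for the entire completed zeta function in the vertical strip `0 ≤ Re s ≤ 2 k - 2`. -/
theorem norm_completedRiemannZeta₀_le {s : ℂ} {k : ℕ} (hk : k ≠ 0) (h0 : 0 ≤ s.re)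
    (hs : s.re ≤ 2 * k - 2) :
    ‖completedRiemannZeta₀ s‖ ≤ 3 * (k.factorial / Real.pi ^ k) := by
  have hk1 : (1 : ℝ) ≤ k := by exact_mod_cast Nat.one_le_iff_ne_zero.2 hk
  set c : ℝ := 2 * k.factorial / Real.pi ^ k with hc
  have hc0 : 0 < c := by positivity
  -- The exponents of the Mellin integrand on (1, ∞) and (0, 1]. The hypotheses on `s.re` give a ≤
  -- -2 and b ≥ -1/2, so the two integrals are at most c and 2c.
  set a : ℝ := s.re / 2 - 1 - k with ha
  set b : ℝ := s.re / 2 - 1 + (k - 1 / 2) with hb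
  have ha1 : a < -1 := by simp only [ha]; linarith
  have hb1 : -1 < b := by simp only [hb]; linarith
  set G : ℝ → ℝ := (Ioi 1).indicator (fun x => c * x ^ a) + (Ioc 0 1).indicator (fun x => c * x ^ b)
    with hG
  have hi1 : IntegrableOn (fun x : ℝ => c * x ^ a) (Ioi 1) :=
    (integrableOn_Ioi_rpow_of_lt ha1 one_pos).const_mul c
  have hi2 : IntegrableOn (fun x : ℝ => c * x ^ b) (Ioc 0 1) := by
    have := (intervalIntegral.intervalIntegrable_rpow' (a := 0) (b := 1) hb1).const_mul c
    rwa [intervalIntegrable_iff_integrableOn_Ioc_of_le zero_le_one] at this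
  have hJ1 : Integrable ((Ioi 1).indicator (fun x : ℝ => c * x ^ a)) :=
    (integrable_indicator_iff measurableSet_Ioi).2 hi1
  have hJ2 : Integrable ((Ioc 0 1).indicator (fun x : ℝ => c * x ^ b)) :=
    (integrable_indicator_iff measurableSet_Ioc).2 hi2
  have hGi : Integrable G := hJ1.add hJ2
  have hGint : ∫ x in Ioi 0, G x = c * (-1 / (a + 1)) + c * (1 / (b + 1)) := by
    have e : ∫ x in Ioi 0, G x = ∫ x, G x := by
      apply setIntegral_eq_integral_of_forall_compl_eq_zero
      intro x hx
      have hx' : x ≤ 0 := by simpa using hx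
      have h1 : x ∉ Ioi (1 : ℝ) := by simp; linarith
      have h2 : x ∉ Ioc (0 : ℝ) 1 := fun h => by linarith [h.1]
      simp [hG, h1, h2]
    rw [e, hG, integral_add' hJ1 hJ2, integral_indicator measurableSet_Ioi,
      integral_indicator measurableSet_Ioc, integral_const_mul, integral_const_mul,
      integral_Ioi_rpow_of_lt ha1 one_pos, ← intervalIntegral.integral_of_le zero_le_one,
      integral_rpow (Or.inl hb1), Real.one_rpow, Real.one_rpow,
      Real.zero_rpow (by linarith), sub_zero]
  have hnorm : ‖mellin (hurwitzEvenFEPair 0).f_modif (s / 2)‖ ≤ ∫ x in Ioi 0, G x := by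
    refine norm_integral_le_of_norm_le hGi.integrableOn ?_
    rw [ae_restrict_iff' measurableSet_Ioi]
    filter_upwards with x hx
    have hx0 : 0 < x := hx
    have hre : (s / 2 - 1).re = s.re / 2 - 1 := by simp
    rw [norm_smul, Complex.norm_cpow_eq_rpow_re_of_pos hx0, hre]
    rcases lt_trichotomy x 1 with h | h | h
    · have h1 : x ∉ Ioi (1 : ℝ) := by simp; linarith
      have h2 : x ∈ Ioc (0 : ℝ) 1 := ⟨hx0, h.le⟩
      have := norm_f_modif_le_of_lt_one hx0 h hk
      simp only [hG, Pi.add_apply, indicator_of_notMem h1, indicator_of_mem h2, zero_add]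
      rw [hb, Real.rpow_add hx0]
      calc _ ≤ x ^ (s.re / 2 - 1) * (c * x ^ ((k : ℝ) - 1 / 2)) := by gcongr
        _ = _ := by ring
    · have : (hurwitzEvenFEPair 0).f_modif x = 0 := by simp [WeakFEPair.f_modif, h]
      rw [this, norm_zero, mul_zero]
      exact add_nonneg (indicator_nonneg (fun y hy => by
        have : (0 : ℝ) < y := one_pos.trans hy
        positivity) _) (indicator_nonneg (fun y hy => by
        have : (0 : ℝ) < y := hy.1
        positivity) _)
    · have h1 : x ∈ Ioi (1 : ℝ) := h
      have h2 : x ∉ Ioc (0 : ℝ) 1 := fun h' => by linarith [h'.2]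
      have := norm_f_modif_le_of_one_lt h hk
      simp only [hG, Pi.add_apply, indicator_of_notMem h2, indicator_of_mem h1, add_zero]
      rw [ha, sub_eq_add_neg _ (k : ℝ), Real.rpow_add hx0]
      calc _ ≤ x ^ (s.re / 2 - 1) * (c * x ^ (-(k : ℝ))) := by gcongr
        _ = _ := by ring
  have e : completedRiemannZeta₀ s = mellin (hurwitzEvenFEPair 0).f_modif (s / 2) / 2 := rfl
  rw [e, norm_div, Complex.norm_ofNat, div_le_iff₀ (by norm_num)]
  refine hnorm.trans ?_
  rw [hGint]
  have h1 : -1 / (a + 1) ≤ 1 := by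
    rw [div_le_one_of_neg (by linarith)]
    simp only [ha]; linarith
  have h2 : 1 / (b + 1) ≤ 2 := by
    rw [div_le_iff₀ (by linarith)]
    simp only [hb]; linarith
  have h3 : 3 * (k.factorial / Real.pi ^ k) * 2 = c * 1 + c * 2 := by rw [hc]; ring
  rw [h3]
  gcongr

/-! ### Symmetry, zero-free regions and growth of `xi` and `Xi`. -/

theorem xi_one_sub (s : ℂ) : xi (1 - s) = xi s := by
  rw [xi, xi, completedRiemannZeta₀_one_sub]
  ring

theorem Xi_neg (t : ℂ) : Xi (-t) = Xi t := by
  rw [Xi, Xi, ← xi_one_sub]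
  congr 1
  ring

theorem differentiable_Xi : Differentiable ℂ Xi := by
  have := differentiable_xi
  unfold Xi
  fun_prop

theorem xi_ne_zero_of_one_le_re {s : ℂ} (hs : 1 ≤ s.re) : xi s ≠ 0 := by
  by_cases h1 : s = 1
  · subst h1
    simp [xi]
  have h0 : s ≠ 0 := by
    rintro rfl
    norm_num at hs
  have hG : ∀ n : ℕ, s ≠ -(2 * (n : ℂ)) := by
    rintro n rfl
    simp at hs
    linarith [Nat.cast_nonneg (α := ℝ) n]
  rw [xi_eq s h1 hG]
  have hΓ : Complex.Gamma (s / 2) ≠ 0 := Complex.Gamma_ne_zero_of_re_pos (by simp; linarith)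
  have hπ : (Real.pi : ℂ) ^ (-s / 2) ≠ 0 := by
    simp [Complex.cpow_eq_zero_iff, Real.pi_ne_zero]
  have hζ := riemannZeta_ne_zero_of_one_le_re hs
  exact mul_ne_zero (mul_ne_zero (mul_ne_zero (div_ne_zero (mul_ne_zero h0 (sub_ne_zero.2 h1))
    two_ne_zero) hπ) hΓ) hζ

/-- The strip bound with k = 2 is 6/π² < 1. -/
theorem norm_completedRiemannZeta₀_lt_one {s : ℂ} (h0 : 0 ≤ s.re) (h1 : s.re ≤ 1) :
    ‖completedRiemannZeta₀ s‖ < 1 := by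
  refine (norm_completedRiemannZeta₀_le (k := 2) (by norm_num) h0 (by norm_num; linarith)).trans_lt ?_
  have := Real.pi_gt_three
  rw [← mul_div_assoc, div_lt_one (by positivity)]
  norm_num [Nat.factorial]
  nlinarith

/-- Inside (0, 1) a zero would force x(1 - x)Λ₀(x) = 1 for Λ₀ = `completedRiemannZeta₀`, although
x(1 - x) ≤ 1 and |Λ₀(x)| < 1. This yields ζ(1/2) ≠ 0 and keeps the zeros of `Xi` off the imaginary
axis. -/
theorem xi_ofReal_ne_zero (x : ℝ) : xi x ≠ 0 := by
  rcases le_or_gt 1 x with h | h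
  · exact xi_ne_zero_of_one_le_re (by simpa using h)
  rcases le_or_gt x 0 with h' | h'
  · rw [← xi_one_sub]
    exact xi_ne_zero_of_one_le_re (by simpa using h')
  intro h0
  have h1 := norm_completedRiemannZeta₀_lt_one (s := x) (by simpa using h'.le) (by simpa using h.le)
  have h2 : (x : ℂ) * (1 - x) * completedRiemannZeta₀ x = 1 := by
    rw [xi] at h0
    linear_combination (-2) * h0
  have h3 := congrArg norm h2
  rw [norm_mul, norm_one, ← Complex.ofReal_one, ← Complex.ofReal_sub, ← Complex.ofReal_mul,
    Complex.norm_real, Real.norm_of_nonneg (by nlinarith)] at h3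
  have h4 : x * (1 - x) ≤ 1 := by nlinarith
  have h5 := mul_le_mul_of_nonneg_right h4 (norm_nonneg (completedRiemannZeta₀ x))
  linarith

theorem Xi_ne_zero_of_re_eq_zero {t : ℂ} (ht : t.re = 0) : Xi t ≠ 0 := by
  have e : 1 / 2 + Complex.I * t = ((1 / 2 - t.im : ℝ) : ℂ) := by
    apply Complex.ext <;> simp [ht, sub_eq_add_neg]
  rw [Xi, e]
  exact xi_ofReal_ne_zero _

theorem abs_im_le_of_Xi_eq_zero {t : ℂ} (ht : Xi t = 0) : |t.im| ≤ 1 / 2 := by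
  have key : ∀ t : ℂ, Xi t = 0 → -(1 / 2) ≤ t.im := by
    -- If Im t < -1/2, then s = 1/2 + it has real part above 1. Evenness of `Xi` supplies the upper
    -- bound.
    intro t ht
    by_contra! h
    refine xi_ne_zero_of_one_le_re ?_ ht
    simp
    linarith
  rw [abs_le]
  refine ⟨key t ht, ?_⟩
  have := key (-t) (by rw [Xi_neg, ht])
  simp at this
  linarith

theorem norm_xi_le {s : ℂ} (hs : 0 ≤ s.re) :
    ‖xi s‖ ≤ Real.exp ((‖s‖ + 4) * Real.log (‖s‖ + 2)) := by
  set r := ‖s‖ with hr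
  have hr0 : 0 ≤ r := norm_nonneg _
  -- This choice gives Re s ≤ r ≤ 2k - 2, as the strip bound requires, with k ≤ r + 2, so that k! ≤
  -- (r + 2)^(r + 2).
  set k : ℕ := ⌈r⌉₊ + 1 with hk
  have hk1 : r + 1 ≤ k := by
    rw [hk]; push_cast; linarith [Nat.le_ceil r]
  have hk2 : (k : ℝ) ≤ r + 2 := by
    rw [hk]; push_cast; linarith [Nat.ceil_lt_add_one hr0]
  have h1 := norm_completedRiemannZeta₀_le (k := k) (by omega) hs
    (by linarith [Complex.re_le_norm s])
  have h2 : 3 * ((k.factorial : ℝ) / Real.pi ^ k) ≤ k.factorial := by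
    have : 3 ≤ Real.pi ^ k := Real.pi_gt_three.le.trans
      (le_self_pow₀ (by linarith [Real.pi_gt_three]) (by omega))
    rw [← mul_div_assoc, div_le_iff₀ (by positivity), mul_comm]
    gcongr
  have h3 : (k.factorial : ℝ) ≤ (r + 2) ^ (r + 2) := by
    calc (k.factorial : ℝ) ≤ (k : ℝ) ^ k := by exact_mod_cast Nat.factorial_le_pow k
      _ ≤ (r + 2) ^ k := by gcongr
      _ = (r + 2) ^ (k : ℝ) := (Real.rpow_natCast _ _).symm
      _ ≤ (r + 2) ^ (r + 2) := Real.rpow_le_rpow_of_exponent_le (by linarith) hk2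
  have h4 : 1 ≤ (r + 2) ^ (r + 2) := Real.one_le_rpow (by linarith) (by linarith)
  set Q := (r + 2) ^ (r + 2) with hQ
  have h5 : ‖xi s‖ ≤ (r * (r + 1) * Q + 1) / 2 := by
    rw [xi, norm_div, Complex.norm_ofNat]
    gcongr
    refine (norm_add_le _ _).trans ?_
    rw [norm_mul, norm_mul, norm_one]
    have h6 : ‖s - 1‖ ≤ r + 1 := by simpa using norm_sub_le s 1
    gcongr
    exact h1.trans (h2.trans h3)
  have h7 : Real.exp ((r + 4) * Real.log (r + 2)) = (r + 2) ^ 2 * Q := by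
    rw [mul_comm, ← Real.rpow_def_of_pos (by linarith), show r + 4 = 2 + (r + 2) by ring,
      Real.rpow_add (by linarith), Real.rpow_two]
  rw [h7]
  refine h5.trans ?_
  nlinarith

/-- The growth is exp(O(r log r)); bounding the logarithm by a square root gives exponent 3/2, and
only an exponent below 2 matters. Evenness reduces to the half-plane Re s ≥ 0. -/
theorem norm_Xi_le (t : ℂ) : ‖Xi t‖ ≤ Real.exp (20 * (1 + ‖t‖) ^ (3 / 2 : ℝ)) := by
  wlog h : 0 ≤ (1 / 2 + Complex.I * t).re generalizing t
  · have := this (-t) (by simp at h ⊢; linarith)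
    rwa [Xi_neg, norm_neg] at this
  refine (norm_xi_le h).trans ?_
  rw [Real.exp_le_exp]
  set T := 1 + ‖t‖ with hT
  have hT1 : 1 ≤ T := by linarith [norm_nonneg t]
  have hn : ‖1 / 2 + Complex.I * t‖ ≤ T - 1 / 2 := by
    refine (norm_add_le _ _).trans ?_
    simp
    linarith
  set r := ‖1 / 2 + Complex.I * t‖
  have hr0 : 0 ≤ r := norm_nonneg _
  have h1 : Real.log (r + 2) ≤ Real.log (3 * T) := Real.log_le_log (by linarith) (by linarith)
  have h2 : Real.log (3 * T) ≤ (3 * T) ^ (1 / 2 : ℝ) / (1 / 2) :=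
    Real.log_le_rpow_div (by positivity) (by norm_num)
  have h3 : (3 * T) ^ (1 / 2 : ℝ) ≤ 2 * T ^ (1 / 2 : ℝ) := by
    rw [Real.mul_rpow (by norm_num) (by positivity)]
    gcongr
    rw [← Real.sqrt_eq_rpow]
    exact Real.sqrt_le_iff.2 ⟨by norm_num, by norm_num⟩
  have h4 : T ^ (3 / 2 : ℝ) = T * T ^ (1 / 2 : ℝ) := by
    rw [show (3 / 2 : ℝ) = 1 + 1 / 2 by norm_num, Real.rpow_add (by positivity), Real.rpow_one]
  have h5 : 0 ≤ T ^ (1 / 2 : ℝ) := by positivity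
  calc (r + 4) * Real.log (r + 2) ≤ (5 * T) * (4 * T ^ (1 / 2 : ℝ)) := by
        gcongr
        · exact Real.log_nonneg (by linarith)
        · linarith
        · linarith
    _ = 20 * T ^ (3 / 2 : ℝ) := by rw [h4]; ring

/-! ### Digamma and trigamma at 1/4. -/

section

open Complex Filter Topology

theorem deriv_eq_ofReal_deriv {f : ℂ → ℂ} {g : ℝ → ℝ} {x : ℝ} (hf : DifferentiableAt ℂ f x)
    (hfg : ∀ᶠ y in 𝓝 x, f (y : ℝ) = g y) : deriv f x = (deriv g x : ℝ) := by
  have h1 : HasDerivAt g (deriv f x).re x := by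
    refine hf.hasDerivAt.real_of_complex.congr_of_eventuallyEq ?_
    filter_upwards [hfg] with y hy
    rw [hy, ofReal_re]
  have h2 : HasDerivAt (fun y : ℝ => f y) (deriv f x) x := hf.hasDerivAt.comp_ofReal
  have h3 : HasDerivAt (fun y : ℝ => f y) ((deriv g x : ℝ) : ℂ) x :=
    (h1.deriv.symm ▸ h1 : HasDerivAt g (deriv g x) x).ofReal_comp.congr_of_eventuallyEq hfg
  exact h2.unique h3

theorem ne_neg_natCast_of_re_pos {s : ℂ} (hs : 0 < s.re) (m : ℕ) : s ≠ -m := by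
  rintro rfl
  simp at hs
  linarith [Nat.cast_nonneg (α := ℝ) m]

theorem analyticAt_Gamma_of_re_pos {s : ℂ} (hs : 0 < s.re) : AnalyticAt ℂ Gamma s := by
  rw [analyticAt_iff_eventually_differentiableAt]
  filter_upwards [(isOpen_lt continuous_const continuous_re).mem_nhds hs] with z hz
  exact differentiableAt_Gamma z (ne_neg_natCast_of_re_pos hz)

theorem analyticAt_digamma_of_re_pos {s : ℂ} (hs : 0 < s.re) : AnalyticAt ℂ digamma s :=
  (analyticAt_Gamma_of_re_pos hs).deriv.div (analyticAt_Gamma_of_re_pos hs)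
    (Gamma_ne_zero_of_re_pos hs)

theorem digamma_ofReal {x : ℝ} (hx : 0 < x) :
    digamma x = (deriv (Real.log ∘ Real.Gamma) x : ℝ) := by
  have h1 : deriv Gamma x = (deriv Real.Gamma x : ℝ) :=
    deriv_eq_ofReal_deriv (analyticAt_Gamma_of_re_pos (by simpa using hx)).differentiableAt
      (Eventually.of_forall Gamma_ofReal)
  have hd : DifferentiableAt ℝ Real.Gamma x := Real.differentiableAt_Gamma fun m => by
    have := Nat.cast_nonneg (α := ℝ) m
    linarith
  rw [digamma_def, logDeriv_apply, h1, Gamma_ofReal, Function.comp_def,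
    deriv.log hd (Real.Gamma_pos_of_pos hx).ne']
  push_cast
  rfl

/-- The derivative of the digamma function on the positive real axis. -/
noncomputable def realTrigamma (x : ℝ) : ℝ := deriv (deriv (Real.log ∘ Real.Gamma)) x

theorem deriv_digamma_ofReal {x : ℝ} (hx : 0 < x) : deriv digamma x = (realTrigamma x : ℝ) := by
  refine deriv_eq_ofReal_deriv (analyticAt_digamma_of_re_pos (by simpa using hx)).differentiableAt ?_
  filter_upwards [lt_mem_nhds hx] with y hy using digamma_ofReal hy

/-- Log-convexity of Γ makes the derivative of log Γ monotone. -/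
theorem realTrigamma_nonneg {x : ℝ} (hx : 0 < x) : 0 ≤ realTrigamma x := by
  have hm : MonotoneOn (deriv (Real.log ∘ Real.Gamma)) (Set.Ioi 0) := by
    refine Real.convexOn_log_Gamma.monotoneOn_deriv fun y hy => ?_
    have hy' : (0 : ℝ) < y := hy
    refine DifferentiableAt.log (Real.differentiableAt_Gamma fun m => ?_)
      (Real.Gamma_pos_of_pos hy').ne'
    have := Nat.cast_nonneg (α := ℝ) m
    linarith
  have := hm.derivWithin_nonneg (x := x)
  rwa [derivWithin_of_isOpen isOpen_Ioi hx] at this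

theorem realTrigamma_add_one {x : ℝ} (hx : 0 < x) :
    realTrigamma x = 1 / x ^ 2 + realTrigamma (x + 1) := by
  have hre : 0 < (x : ℂ).re := by simpa using hx
  have hne : (x : ℂ) ≠ 0 := by exact_mod_cast hx.ne'
  have h1 : (fun s : ℂ => digamma (s + 1)) =ᶠ[𝓝 (x : ℂ)] fun s => digamma s + s⁻¹ := by
    filter_upwards [(isOpen_lt continuous_const continuous_re).mem_nhds hre] with z hz
    exact digamma_apply_add_one z (ne_neg_natCast_of_re_pos hz)
  have h2 := h1.deriv_eq
  rw [deriv_comp_add_const, deriv_fun_add (analyticAt_digamma_of_re_pos hre).differentiableAt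
    (differentiableAt_inv hne), deriv_inv, deriv_digamma_ofReal hx, ← ofReal_one, ← ofReal_add,
    deriv_digamma_ofReal (by linarith)] at h2
  have h3 : realTrigamma (x + 1) = realTrigamma x + -(x ^ 2)⁻¹ := by exact_mod_cast h2
  rw [h3]
  ring

/-- The recurrence telescopes with a nonnegative remainder. An inequality suffices: at 1/4 and 3/4
it becomes an equality through the known total. -/
theorem summable_and_tsum_le_realTrigamma {x : ℝ} (hx : 0 < x) :
    Summable (fun n : ℕ => 1 / ((n : ℝ) + x) ^ 2) ∧
      ∑' n : ℕ, 1 / ((n : ℝ) + x) ^ 2 ≤ realTrigamma x := by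
  have h : ∀ N : ℕ, ∑ n ∈ Finset.range N, 1 / ((n : ℝ) + x) ^ 2 + realTrigamma (N + x)
      = realTrigamma x := by
    intro N
    induction N with
    | zero => simp
    | succ N ih =>
      rw [← ih, Finset.sum_range_succ, realTrigamma_add_one (x := N + x) (by positivity)]
      push_cast
      rw [add_right_comm (N : ℝ) 1 x]
      ring
  have hb : ∀ N : ℕ, ∑ n ∈ Finset.range N, 1 / ((n : ℝ) + x) ^ 2 ≤ realTrigamma x := fun N => by
    linarith [h N, realTrigamma_nonneg (x := N + x) (by positivity)]
  exact ⟨summable_of_sum_range_le (fun n => by positivity) hb,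
    Real.tsum_le_of_sum_range_le (fun n => by positivity) hb⟩

/-- Logarithmic derivative of Euler's reflection formula. -/
theorem digamma_sub_digamma_one_sub {s : ℂ} (h0 : 0 < s.re) (h1 : s.re < 1) :
    sin (Real.pi * s) ≠ 0 ∧
      digamma s - digamma (1 - s) = -(Real.pi * cos (Real.pi * s)) / sin (Real.pi * s) := by
  have h1' : 0 < (1 - s).re := by simpa using h1
  have hG : Gamma s ≠ 0 := Gamma_ne_zero_of_re_pos h0
  have hG1 : Gamma (1 - s) ≠ 0 := Gamma_ne_zero_of_re_pos h1'
  have hsin : sin (Real.pi * s) ≠ 0 := by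
    intro h
    have := Gamma_mul_Gamma_one_sub s
    rw [h, div_zero] at this
    exact mul_ne_zero hG hG1 this
  refine ⟨hsin, ?_⟩
  have hd1 : HasDerivAt (fun z => Gamma (1 - z)) (-deriv Gamma (1 - s)) s := by
    have := (analyticAt_Gamma_of_re_pos h1').differentiableAt.hasDerivAt
    simpa using this.comp_const_sub 1 s
  have e : (fun z => Gamma z * Gamma (1 - z)) = fun z => Real.pi / sin (Real.pi * z) :=
    funext Gamma_mul_Gamma_one_sub
  have h2 : logDeriv (fun z => Gamma z * Gamma (1 - z)) s = digamma s - digamma (1 - s) := by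
    rw [logDeriv_mul s hG hG1 (analyticAt_Gamma_of_re_pos h0).differentiableAt
      hd1.differentiableAt, logDeriv_apply (fun z => Gamma (1 - z)), hd1.deriv, digamma_def,
      logDeriv_apply Gamma (1 - s)]
    ring
  have hs : HasDerivAt (fun z : ℂ => sin (Real.pi * z)) (cos (Real.pi * s) * Real.pi) s := by
    simpa using ((hasDerivAt_id s).const_mul (Real.pi : ℂ)).csin
  rw [← h2, e, logDeriv_div s (by simp [Real.pi_ne_zero]) hsin (by fun_prop) hs.differentiableAt,
    logDeriv_const, logDeriv_apply, hs.deriv]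
  simp
  ring

/-- Logarithmic derivative of Legendre's duplication formula. -/
theorem digamma_add_digamma_add_half {s : ℂ} (h0 : 0 < s.re) :
    digamma s + digamma (s + 1 / 2) = 2 * digamma (2 * s) - 2 * Real.log 2 := by
  have h1 : 0 < (s + 1 / 2).re := by simp; linarith
  have h2 : 0 < (2 * s).re := by simpa using h0
  have hG0 := Gamma_ne_zero_of_re_pos h0
  have hG1 := Gamma_ne_zero_of_re_pos h1
  have hG2 := Gamma_ne_zero_of_re_pos h2
  have hd1 : HasDerivAt (fun z => Gamma (z + 1 / 2)) (deriv Gamma (s + 1 / 2)) s :=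
    (analyticAt_Gamma_of_re_pos h1).differentiableAt.hasDerivAt.comp_add_const s (1 / 2)
  have hd2 : HasDerivAt (fun z => Gamma (2 * z)) (deriv Gamma (2 * s) * 2) s := by
    have := (analyticAt_Gamma_of_re_pos h2).differentiableAt.hasDerivAt
    exact this.comp s (by simpa using (hasDerivAt_id s).const_mul (2 : ℂ))
  have hd3 : HasDerivAt (fun z : ℂ => (2 : ℂ) ^ (1 - 2 * z))
      ((2 : ℂ) ^ (1 - 2 * s) * log 2 * (-2)) s := by
    have h := ((hasDerivAt_id s).const_mul (2 : ℂ)).const_sub 1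
    simpa using h.const_cpow (c := 2) (Or.inl two_ne_zero)
  have hp : (2 : ℂ) ^ (1 - 2 * s) ≠ 0 := by simp [cpow_eq_zero_iff]
  have e : (fun z => Gamma z * Gamma (z + 1 / 2))
      = fun z => Gamma (2 * z) * (2 : ℂ) ^ (1 - 2 * z) * (√Real.pi : ℂ) :=
    funext Gamma_mul_Gamma_add_half
  have hl : logDeriv (fun z => Gamma z * Gamma (z + 1 / 2)) s
      = digamma s + digamma (s + 1 / 2) := by
    rw [logDeriv_mul s hG0 hG1 (analyticAt_Gamma_of_re_pos h0).differentiableAt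
      hd1.differentiableAt, logDeriv_apply (fun z => Gamma (z + 1 / 2)), hd1.deriv, digamma_def,
      logDeriv_apply Gamma (s + 1 / 2)]
  rw [← hl, e, logDeriv_mul_const _ _ (by simp [Real.sqrt_eq_zero', Real.pi_pos]),
    logDeriv_mul s hG2 hp hd2.differentiableAt hd3.differentiableAt, logDeriv_apply, hd2.deriv,
    logDeriv_apply, hd3.deriv, digamma_def, logDeriv_apply, ofReal_log (by norm_num)]
  push_cast
  field_simp
  ring

theorem sin_pi_div_four_complex : sin (Real.pi * (1 / 4 : ℂ)) = ((√2 / 2 : ℝ) : ℂ) := by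
  rw [show (Real.pi * (1 / 4 : ℂ)) = ((Real.pi / 4 : ℝ) : ℂ) by push_cast; ring, ← ofReal_sin,
    Real.sin_pi_div_four]

theorem cos_pi_div_four_complex : cos (Real.pi * (1 / 4 : ℂ)) = ((√2 / 2 : ℝ) : ℂ) := by
  rw [show (Real.pi * (1 / 4 : ℂ)) = ((Real.pi / 4 : ℝ) : ℂ) by push_cast; ring, ← ofReal_cos,
    Real.cos_pi_div_four]

/-- Reflection and duplication at 1/4 are two linear equations in ψ(1/4) and ψ(3/4), with ψ(1/2)
known. -/
theorem digamma_one_fourth : digamma (1 / 4)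
    = ((-Real.eulerMascheroniConstant - Real.pi / 2 - 3 * Real.log 2 : ℝ) : ℂ) := by
  obtain ⟨h1, h2⟩ := digamma_sub_digamma_one_sub (s := 1 / 4) (by norm_num) (by norm_num)
  have h3 := digamma_add_digamma_add_half (s := 1 / 4) (by norm_num)
  rw [show (1 : ℂ) - 1 / 4 = 3 / 4 by norm_num] at h2
  rw [show (1 : ℂ) / 4 + 1 / 2 = 3 / 4 by norm_num, show (2 : ℂ) * (1 / 4) = 1 / 2 by norm_num,
    digamma_one_half] at h3
  rw [cos_pi_div_four_complex, ← sin_pi_div_four_complex, neg_div, mul_div_cancel_right₀ _ h1] at h2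
  push_cast
  rw [ofReal_log (by norm_num)] at h3 ⊢
  push_cast at h3 ⊢
  linear_combination (h2 + h3) / 2

/-- The reflection formula for ψ, differentiated at 1/4, gives π²/sin²(π/4). -/
theorem realTrigamma_one_fourth_add_three_fourths :
    realTrigamma (1 / 4) + realTrigamma (3 / 4) = 2 * Real.pi ^ 2 := by
  have hev : (fun s => digamma s - digamma (1 - s)) =ᶠ[𝓝 (1 / 4 : ℂ)]
      fun s => -(Real.pi * cos (Real.pi * s)) / sin (Real.pi * s) := by
    filter_upwards [(isOpen_lt continuous_const continuous_re).mem_nhds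
      (by norm_num : (0 : ℝ) < (1 / 4 : ℂ).re), (isOpen_lt continuous_re continuous_const).mem_nhds
      (by norm_num : (1 / 4 : ℂ).re < (1 : ℝ))] with z h0 h1
    exact (digamma_sub_digamma_one_sub h0 h1).2
  have hsin := (digamma_sub_digamma_one_sub (s := 1 / 4) (by norm_num) (by norm_num)).1
  have hs : HasDerivAt (fun z : ℂ => sin (Real.pi * z)) (cos (Real.pi * (1 / 4)) * Real.pi) (1 / 4) :=
    by simpa using ((hasDerivAt_id (1 / 4 : ℂ)).const_mul (Real.pi : ℂ)).csin
  have hc : HasDerivAt (fun z : ℂ => cos (Real.pi * z)) (-sin (Real.pi * (1 / 4)) * Real.pi) (1 / 4) :=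
    by simpa using ((hasDerivAt_id (1 / 4 : ℂ)).const_mul (Real.pi : ℂ)).ccos
  have hR := ((hc.const_mul (Real.pi : ℂ)).neg.div hs hsin).deriv
  have hd4 : HasDerivAt digamma (realTrigamma (1 / 4) : ℝ) (1 / 4 : ℂ) := by
    have := (analyticAt_digamma_of_re_pos (s := (1 / 4 : ℝ)) (by norm_num)).differentiableAt.hasDerivAt
    rw [deriv_digamma_ofReal (by norm_num)] at this
    simpa using this
  have hd34 : HasDerivAt digamma (realTrigamma (3 / 4) : ℝ) (1 - 1 / 4 : ℂ) := by
    have := (analyticAt_digamma_of_re_pos (s := (3 / 4 : ℝ)) (by norm_num)).differentiableAt.hasDerivAt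
    rw [deriv_digamma_ofReal (by norm_num)] at this
    rw [show (1 - 1 / 4 : ℂ) = ((3 / 4 : ℝ) : ℂ) by push_cast; norm_num]
    exact this
  have hL := (hd4.sub (hd34.comp_const_sub 1 (1 / 4))).deriv
  have h := hL.symm.trans (hev.deriv_eq.trans hR)
  simp only [Pi.neg_apply] at h
  rw [cos_pi_div_four_complex, sin_pi_div_four_complex] at h
  have h2 : ((√2 / 2 : ℝ) : ℂ) ^ 2 = 1 / 2 := by
    rw [← ofReal_pow, div_pow, Real.sq_sqrt (by norm_num)]
    push_cast; norm_num
  have h3 : ((√2 / 2 : ℝ) : ℂ) ≠ 0 := by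
    rw [← sin_pi_div_four_complex]; exact hsin
  have h4 : ((realTrigamma (1 / 4) + realTrigamma (3 / 4) : ℝ) : ℂ)
      = ((2 * Real.pi ^ 2 : ℝ) : ℂ) := by
    push_cast at h ⊢
    rw [sub_neg_eq_add] at h
    rw [h]
    push_cast at h2 h3
    rw [div_eq_iff (pow_ne_zero 2 h3)]
    ring
  exact_mod_cast h4

theorem realTrigamma_one_fourth :
    realTrigamma (1 / 4) = Real.pi ^ 2 + 8 * catalanConstant := by
  obtain ⟨hsA, hA⟩ := summable_and_tsum_le_realTrigamma (x := 1 / 4) (by norm_num)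
  obtain ⟨hsB, hB⟩ := summable_and_tsum_le_realTrigamma (x := 3 / 4) (by norm_num)
  set A := ∑' n : ℕ, 1 / ((n : ℝ) + 1 / 4) ^ 2
  set B := ∑' n : ℕ, 1 / ((n : ℝ) + 3 / 4) ^ 2
  have ha : HasSum (fun n : ℕ => 1 / (4 * (n : ℝ) + 1) ^ 2) (A / 16) := by
    convert! hsA.hasSum.div_const 16 using 2 with n
    field_simp
    norm_num
  have hb : HasSum (fun n : ℕ => 1 / (4 * (n : ℝ) + 3) ^ 2) (B / 16) := by
    convert! hsB.hasSum.div_const 16 using 2 with n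
    field_simp
    norm_num
  have hodd : HasSum (fun m : ℕ => 1 / (2 * (m : ℝ) + 1) ^ 2) (A / 16 + B / 16) := by
    refine HasSum.even_add_odd ?_ ?_
    · convert! ha using 4 with n
      push_cast; ring
    · convert! hb using 4 with n
      push_cast; ring
  have hcat : HasSum (fun m : ℕ => (-1 : ℝ) ^ m / (2 * (m : ℝ) + 1) ^ 2) (A / 16 + -(B / 16)) := by
    refine HasSum.even_add_odd ?_ ?_
    · convert! ha using 2 with n
      rw [pow_mul]
      push_cast
      norm_num
      ring_nf
    · convert! hb.neg using 2 with n
      rw [pow_succ, pow_mul]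
      push_cast
      norm_num
      ring_nf
  have hG : catalanConstant = A / 16 + -(B / 16) := hcat.tsum_eq
  have hz : HasSum (fun n : ℕ => 1 / (n : ℝ) ^ 2) (Real.pi ^ 2 / 6 / 4 + (A / 16 + B / 16)) := by
    refine HasSum.even_add_odd ?_ ?_
    · convert! hasSum_zeta_two.div_const 4 using 2 with n
      push_cast
      rw [mul_pow]
      field_simp
      norm_num
    · convert! hodd using 4 with n
      push_cast; ring
  have h1 := hz.unique hasSum_zeta_two
  have h2 := realTrigamma_one_fourth_add_three_fourths
  -- Splitting ζ(2) by parity gives A + B = 2π², which is also ψ'(1/4) + ψ'(3/4). As A ≤ ψ'(1/4) and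
  -- B ≤ ψ'(3/4), both are equalities, and A - B = 16G determines A.
  linarith

/-! ### Existence of the ordered, infinite sequence of zeros. -/

/-- A function on an infinite type with finite sublevel sets can be arranged in increasing order. -/
theorem exists_equiv_nat_monotone {I : Type*} [Infinite I] (v : I → ℝ)
    (hv : ∀ R : ℝ, {i | v i ≤ R}.Finite) : ∃ e : ℕ ≃ I, Monotone (v ∘ e) := by
  classical
  have hcount : Countable I := by
    rw [← Set.countable_univ_iff]
    refine (Set.countable_iUnion fun n : ℕ => (hv n).countable).mono fun i _ => ?_
    obtain ⟨n, hn⟩ := exists_nat_ge (v i)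
    exact Set.mem_iUnion.2 ⟨n, hn⟩
  obtain ⟨c, hc⟩ := hcount.exists_injective_nat
  -- Ties in `v` are broken by an injection into ℕ, so the key is injective and the number of
  -- smaller keys is an injective rank.
  set key : I → ℝ ×ₗ ℕ := fun i => toLex (v i, c i) with hkey
  have hkinj : Function.Injective key := fun i j h => by
    have h1 : (v i, c i) = (v j, c j) := toLex.injective h
    exact hc (Prod.mk.inj h1).2
  have hle : ∀ i j, key j ≤ key i → v j ≤ v i := fun i j h => by
    rcases Prod.Lex.le_iff.1 h with h | h
    · exact h.le
    · exact h.1.le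
  have hfin : ∀ i, {j | key j < key i}.Finite := fun i =>
    (hv (v i)).subset fun j hj => hle i j (le_of_lt hj)
  set rank : I → ℕ := fun i => {j | key j < key i}.ncard with hrank
  have hlt : ∀ i j, key i < key j → rank i < rank j := fun i j h => by
    refine Set.ncard_lt_ncard ⟨fun l hl => lt_trans hl h, fun hsub => ?_⟩ (hfin j)
    have h' : key i < key i := hsub h
    exact lt_irrefl _ h'
  have hinj : Function.Injective rank := fun i j h => by
    by_contra hne
    rcases lt_or_gt_of_ne (fun h' => hne (hkinj h')) with h' | h'
    · exact (hlt _ _ h').ne h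
    · exact (hlt _ _ h').ne' h
  have : Infinite (Set.range rank) := (Set.infinite_range_of_injective hinj).to_subtype
  have : DecidablePred (· ∈ Set.range rank) := Classical.decPred _
  set o := Nat.Subtype.orderIsoOfNat (Set.range rank)
  refine ⟨o.toEquiv.trans (Equiv.ofInjective rank hinj).symm, fun m n hmn => ?_⟩
  set e := o.toEquiv.trans (Equiv.ofInjective rank hinj).symm with he
  have hre : ∀ n, rank (e n) = o n := fun n => by
    simp [he, Equiv.apply_ofInjective_symm]
  by_contra! hcon
  have h1 : key (e n) < key (e m) := Prod.Lex.lt_iff.2 (Or.inl hcon)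
  have h2 := hlt _ _ h1
  rw [hre, hre] at h2
  exact absurd (o.monotone hmn) (not_le.2 h2)

theorem analyticOrderAt_Xi_neg (z : ℂ) : analyticOrderAt Xi (-z) = analyticOrderAt Xi z := by
  have h := analyticOrderAt_comp_of_deriv_ne_zero (f := Xi) (g := fun z : ℂ => -z) (z₀ := z)
    (by fun_prop) (by simp)
  rw [← h]
  congr 1
  ext t
  simp [Xi_neg]

theorem analyticOrderAt_Xi_eq_zero_of_re_eq_zero {z : ℂ} (hz : z.re = 0) :
    analyticOrderAt Xi z = 0 :=
  analyticOrderAt_eq_zero.2 (Or.inr (Xi_ne_zero_of_re_eq_zero hz))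

theorem Xi_zero_ne_zero : Xi 0 ≠ 0 := Xi_ne_zero_of_re_eq_zero rfl

/-- A list of the zeros of `Xi` with positive real part yields a list of all zeros. -/
theorem encard_sumElim_eq {ι : Type*} {v : ι → ℂ} (hpos : ∀ i, 0 < (v i).re)
    (hv : ∀ z : ℂ, 0 < z.re → {i | v i = z}.encard = analyticOrderAt Xi z) (w : ℂ) :
    {i | Sum.elim v (-v) i = w}.encard = analyticOrderAt Xi w := by
  rcases lt_trichotomy w.re 0 with h | h | h
  · have e : {i | Sum.elim v (-v) i = w} = Sum.inr '' {i | v i = -w} := by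
      ext i
      rcases i with i | i
      · simp only [Set.mem_ofPred_eq, Sum.elim_inl, Set.mem_image, reduceCtorEq, and_false,
          exists_false, iff_false]
        rintro rfl
        exact lt_asymm h (hpos i)
      · simp [neg_eq_iff_eq_neg]
    rw [e, Sum.inr_injective.encard_image, hv _ (by simpa using h), analyticOrderAt_Xi_neg]
  · rw [analyticOrderAt_Xi_eq_zero_of_re_eq_zero h, Set.encard_eq_zero, Set.eq_empty_iff_forall_notMem]
    rintro (i | i) hi
    · have : v i = w := hi
      exact (hpos i).ne' (by rw [this, h])
    · have : -v i = w := hi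
      have h2 := congrArg re this
      rw [neg_re, h] at h2
      linarith [hpos i]
  · have e : {i | Sum.elim v (-v) i = w} = Sum.inl '' {i | v i = w} := by
      ext i
      rcases i with i | i
      · simp
      · simp only [Set.mem_ofPred_eq, Sum.elim_inr, Set.mem_image, reduceCtorEq, and_false,
          exists_false, iff_false]
        rintro rfl
        simp at h
        exact lt_asymm h (hpos i)
    rw [e, Sum.inl_injective.encard_image, hv _ h]

theorem one_le_norm_riemannZeta_natCast {k : ℕ} (hk : 1 < k) : 1 ≤ ‖riemannZeta k‖ := by
  rw [zeta_nat_eq_tsum_of_gt_one hk]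
  have e : ∑' n : ℕ, 1 / (n : ℂ) ^ k = ((∑' n : ℕ, 1 / (n : ℝ) ^ k : ℝ) : ℂ) := by
    rw [ofReal_tsum]
    push_cast
    rfl
  have hs : Summable fun n : ℕ => 1 / (n : ℝ) ^ k := Real.summable_one_div_nat_pow.2 hk
  have h1 := hs.le_tsum 1 (fun n _ => by positivity)
  rw [e, norm_real]
  refine le_trans ?_ (le_abs_self _)
  simpa using h1

/-- At s = 2n the Gamma factor is (n - 1)!, the polynomial n(2n - 1) ≥ n completes it to n!, and
ζ(2n) ≥ 1. -/
theorem factorial_div_pow_le_norm_xi {n : ℕ} (hn : 1 ≤ n) :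
    (n.factorial : ℝ) / Real.pi ^ n ≤ ‖xi (2 * n)‖ := by
  obtain ⟨m, rfl⟩ : ∃ m, n = m + 1 := ⟨n - 1, by omega⟩
  have hζ := one_le_norm_riemannZeta_natCast (k := 2 * (m + 1)) (by omega)
  have hre : (2 * ((m + 1 : ℕ) : ℂ)).re = 2 * ((m : ℝ) + 1) := by simp
  have hm := Nat.cast_nonneg (α := ℝ) m
  rw [xi_eq]
  · have e1 : -(2 * ((m + 1 : ℕ) : ℂ)) / 2 = -((m + 1 : ℕ) : ℂ) := by ring
    have e2 : 2 * ((m + 1 : ℕ) : ℂ) / 2 = (m : ℂ) + 1 := by push_cast; ring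
    have e3 : 2 * ((m + 1 : ℕ) : ℂ) = ((2 * (m + 1) : ℕ) : ℂ) := by push_cast; ring
    have e4 : 2 * ((m + 1 : ℕ) : ℂ) * (2 * ((m + 1 : ℕ) : ℂ) - 1) / 2
        = (((m : ℝ) + 1) * (2 * m + 1) : ℝ) := by push_cast; ring
    rw [e4, e1, e2, e3, Gamma_nat_eq_factorial, cpow_neg, cpow_natCast, norm_mul, norm_mul,
      norm_mul, norm_real, norm_inv, norm_pow, norm_real, norm_natCast,
      Real.norm_of_nonneg (by positivity), Real.norm_of_nonneg Real.pi_pos.le,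
      Nat.factorial_succ]
    push_cast at hζ ⊢
    have h5 : 0 < (Real.pi ^ (m + 1))⁻¹ := by positivity
    have h6 : (0 : ℝ) < m.factorial := by positivity
    calc ((m : ℝ) + 1) * m.factorial / Real.pi ^ (m + 1)
        = ((m : ℝ) + 1) * 1 * (Real.pi ^ (m + 1))⁻¹ * m.factorial * 1 := by ring
      _ ≤ _ := by gcongr; linarith
  · intro h
    have := congrArg re h
    rw [hre, one_re] at this
    linarith
  · intro k h
    have := congrArg re h
    rw [hre] at this
    simp at this
    linarith [Nat.cast_nonneg (α := ℝ) k]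

/-- Not every value of `Xi ^ 2` is bounded by a fixed power. -/
theorem not_norm_Xi_sq_le (K : ℝ) (M : ℕ) (h : ∀ z, ‖Xi z‖ ^ 2 ≤ K * (1 + ‖z‖) ^ M) : False := by
  have hK : 0 ≤ K := by
    have := h 0
    simp at this
    exact (sq_nonneg _).trans this
  -- The e³ comes from (3n)^M ≤ M! e^(3n), the π² from squaring π^n. The polynomial bound would then
  -- give n! ≤ K · M! · a^n for all n ≥ 1.
  set a : ℝ := Real.pi ^ 2 * Real.exp 3 with ha
  have ha0 : 0 < a := by positivity
  have hb : ∀ n : ℕ, 1 ≤ n → 1 ≤ K * M.factorial * (a ^ n / n.factorial) := by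
    intro n hn
    have hn' : (1 : ℝ) ≤ n := by exact_mod_cast hn
    have h1 := factorial_div_pow_le_norm_xi hn
    have e : xi (2 * n) = Xi (-(I * (2 * n - 1 / 2))) := by
      rw [Xi]
      congr 1
      linear_combination (2 * (n : ℂ) - 1 / 2) * I_sq
    have hnorm : 1 + ‖-(I * (2 * (n : ℂ) - 1 / 2))‖ ≤ 3 * n := by
      have : (2 * (n : ℂ) - 1 / 2) = ((2 * n - 1 / 2 : ℝ) : ℂ) := by push_cast; ring
      rw [norm_neg, norm_mul, norm_I, one_mul, this, norm_real, Real.norm_of_nonneg (by linarith)]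
      linarith
    have h2 : ((n.factorial : ℝ) / Real.pi ^ n) ^ 2 ≤ K * (3 * n) ^ M := by
      calc ((n.factorial : ℝ) / Real.pi ^ n) ^ 2 ≤ ‖xi (2 * n)‖ ^ 2 := by gcongr
        _ ≤ K * (1 + ‖-(I * (2 * (n : ℂ) - 1 / 2))‖) ^ M := by rw [e]; exact h _
        _ ≤ _ := by gcongr
    have h3 : (3 * (n : ℝ)) ^ M ≤ M.factorial * Real.exp 3 ^ n := by
      have := Real.pow_div_factorial_le_exp (3 * n) (by positivity) M
      rw [div_le_iff₀ (by positivity)] at this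
      rw [← Real.exp_nat_mul, mul_comm (n : ℝ), mul_comm (M.factorial : ℝ)]
      exact this
    have h4 : (1 : ℝ) ≤ n.factorial := by exact_mod_cast Nat.one_le_iff_ne_zero.2 n.factorial_ne_zero
    rw [← mul_div_assoc, le_div_iff₀ (by positivity), one_mul]
    calc (n.factorial : ℝ) ≤ (n.factorial : ℝ) ^ 2 := by nlinarith
      _ = ((n.factorial : ℝ) / Real.pi ^ n) ^ 2 * (Real.pi ^ 2) ^ n := by
          rw [div_pow, ← pow_mul, ← pow_mul, mul_comm n 2]
          field_simp
      _ ≤ K * (M.factorial * Real.exp 3 ^ n) * (Real.pi ^ 2) ^ n := by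
          gcongr
          exact h2.trans (by gcongr)
      _ = K * M.factorial * a ^ n := by rw [ha, mul_pow]; ring
  have hlim := (FloorSemiring.tendsto_pow_div_factorial_atTop a).const_mul (K * M.factorial)
  rw [mul_zero] at hlim
  have := ge_of_tendsto hlim (eventually_atTop.2 ⟨1, hb⟩)
  linarith

open Metric in
/-- A zero-free quotient of an entire function of order less than two by finitely many linear
factors has constant logarithmic derivative. -/
theorem deriv_logDeriv_eq_zero_of_eq_mul_prod {ι : Type*} {β : ι → ℂ} {f g : ℂ → ℂ} {C p : ℝ}
    (hg : Differentiable ℂ g) {S : Finset ι} (hfg : ∀ z, f z = g z * ∏ i ∈ S, (1 - z / β i))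
    (hβ : ∀ i ∈ S, β i ≠ 0) (hg0 : ∀ z, g z ≠ 0) (hC : 0 ≤ C) (hp : 0 ≤ p) (hp2 : p < 2)
    (hgr : ∀ z, ‖f z‖ ≤ Real.exp (C * (1 + ‖z‖) ^ p)) (c : ℂ) : deriv (logDeriv g) c = 0 := by
  -- For n ≥ N the disc of radius n + 1 about c lies within radius 2(n + 1) of the origin, and every
  -- divided-out zero has norm at most n + 1.
  obtain ⟨N, hN⟩ := exists_nat_ge (‖c‖ + ∑ i ∈ S, ‖β i‖)
  have hlim := tendsto_growth_div_sq hC (K := |Real.log ‖g c‖| + 1) (by positivity) hp hp2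
  have hev : ∀ᶠ n : ℕ in atTop, ‖deriv (logDeriv g) c‖
      ≤ 16 * (C * (1 + 2 * ((n : ℝ) + 1)) ^ p + (|Real.log ‖g c‖| + 1)) / ((n : ℝ) + 1) ^ 2 := by
    filter_upwards [eventually_ge_atTop N] with n hn
    have hn' : (N : ℝ) ≤ n := by exact_mod_cast hn
    have hc : ‖c‖ ≤ (n : ℝ) + 1 := by
      have : 0 ≤ ∑ i ∈ S, ‖β i‖ := Finset.sum_nonneg fun _ _ => norm_nonneg _
      linarith
    have hβn : ∀ i ∈ S, ‖β i‖ ≤ (n : ℝ) + 1 := fun i hi => by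
      have := Finset.single_le_sum (f := fun i => ‖β i‖) (fun _ _ => norm_nonneg _) hi
      linarith [norm_nonneg c]
    have hR : (0 : ℝ) < (n : ℝ) + 1 := by positivity
    refine norm_deriv_logDeriv_le hg hR (by positivity) (fun w _ => hg0 w) fun w hw => ?_
    have h1 := norm_le_of_eq_mul_prod hg hfg (ρ := 1)
      (M := Real.exp (C * (1 + 2 * ((n : ℝ) + 1)) ^ p)) hR le_rfl hβ hβn (fun z hz => by
        have hz' : ‖z‖ = 2 * ((n : ℝ) + 1) := by
          have : ‖z‖ = (1 + 1) * ((n : ℝ) + 1) := by simpa using hz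
          rw [this]; norm_num
        simpa [hz'] using hgr z) (z := w) (by
        have hw' : ‖w - c‖ < (n : ℝ) + 1 := mem_ball_iff_norm.1 hw
        simp only [mem_closedBall, dist_zero_right]
        have := norm_add_le (w - c) c
        rw [sub_add_cancel] at this
        linarith)
    rw [one_pow, mul_one] at h1
    refine h1.trans ?_
    have hpos : 0 < ‖g c‖ := norm_pos_iff.2 (hg0 c)
    nth_rw 2 [← Real.exp_log hpos]
    rw [← Real.exp_add, Real.exp_le_exp]
    linarith [neg_abs_le (Real.log ‖g c‖)]
  have := ge_of_tendsto hlim hev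
  exact norm_le_zero_iff.1 this

/-- Such a `g` is a constant times e^(az), and the exponential cancels in the product. -/
theorem mul_neg_eq_of_deriv_logDeriv_eq_zero {g : ℂ → ℂ} (hg : Differentiable ℂ g)
    (hg0 : ∀ z, g z ≠ 0) (h : ∀ z, deriv (logDeriv g) z = 0) (z : ℂ) : g z * g (-z) = g 0 ^ 2 := by
  have hd : Differentiable ℂ (logDeriv g) := fun z =>
    (hg.deriv z).div (hg z) (hg0 z)
  have hconst : ∀ z, logDeriv g z = logDeriv g 0 := fun z => is_const_of_deriv_eq_zero hd h z 0
  have hder : ∀ z, deriv g z = logDeriv g 0 * g z := fun z => by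
    rw [← hconst z, logDeriv_apply, div_mul_cancel₀ _ (hg0 z)]
  have hprod : ∀ z, HasDerivAt (fun z => g z * g (-z)) 0 z := fun z => by
    have h1 := (hg z).hasDerivAt.mul (((hg (-z)).hasDerivAt).comp z (hasDerivAt_neg z))
    convert! h1 using 1
    rw [hder, hder]
    simp only [Function.comp]
    ring
  have := is_const_of_deriv_eq_zero (fun z => (hprod z).differentiableAt)
    (fun z => (hprod z).deriv) z 0
  simpa [sq] using this

theorem norm_prod_one_sub_div_le {ι : Type*} (β : ι → ℂ) (S : Finset ι) (z : ℂ) :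
    ‖∏ i ∈ S, (1 - z / β i)‖ ≤ (∏ i ∈ S, (1 + ‖β i‖⁻¹)) * (1 + ‖z‖) ^ S.card := by
  rw [norm_prod, ← Finset.prod_const, ← Finset.prod_mul_distrib]
  refine Finset.prod_le_prod (fun _ _ => norm_nonneg _) fun i _ => ?_
  refine (norm_sub_le _ _).trans ?_
  rw [norm_one, norm_div, div_eq_mul_inv]
  have h1 := norm_nonneg z
  have h2 : 0 ≤ ‖β i‖⁻¹ := by positivity
  nlinarith

/-- `Xi` has infinitely many zeros. -/
theorem infinite_of_encard_eq {ι : Type*} {β : ι → ℂ}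
    (hβ : ∀ w, {i | β i = w}.encard = analyticOrderAt Xi w) : Infinite ι := by
  by_contra hinf
  rw [not_infinite_iff_finite] at hinf
  have := Fintype.ofFinite ι
  have hne := ne_zero_of_encard_eq Xi_zero_ne_zero hβ
  obtain ⟨g, hg, hfg, hord⟩ := exists_eq_mul_prod differentiable_Xi Finset.univ (fun i _ => hne i)
    (card_filter_le_order hβ Finset.univ)
  have hg0 : ∀ w, g w ≠ 0 := fun w =>
    ne_zero_of_order_eq_add_card hβ (hg.analyticAt w) (fun i _ => Finset.mem_univ i) (hord w)
  have hdl := deriv_logDeriv_eq_zero_of_eq_mul_prod hg hfg (fun i _ => hne i) hg0 (by norm_num)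
    (by norm_num) (by norm_num) norm_Xi_le
  have hsym := mul_neg_eq_of_deriv_logDeriv_eq_zero hg hg0 hdl
  set Q := ∏ i : ι, (1 + ‖β i‖⁻¹)
  set N := (Finset.univ : Finset ι).card
  refine not_norm_Xi_sq_le (‖g 0‖ ^ 2 * Q ^ 2) (2 * N) fun z => ?_
  -- Evenness turns the square into Ξ(z)Ξ(-z), from which the unknown exponential factor drops out;
  -- a polynomial remains.
  have e : Xi z ^ 2 = g 0 ^ 2 * ((∏ i, (1 - z / β i)) * ∏ i, (1 - (-z) / β i)) := by
    rw [sq]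
    nth_rw 2 [← Xi_neg]
    rw [hfg z, hfg (-z), ← hsym z]
    ring
  rw [← norm_pow, e, norm_mul, norm_mul, norm_pow, mul_assoc (‖g 0‖ ^ 2)]
  have h1 := norm_prod_one_sub_div_le β Finset.univ z
  have h2 := norm_prod_one_sub_div_le β Finset.univ (-z)
  rw [norm_neg] at h2
  refine mul_le_mul_of_nonneg_left ?_ (by positivity)
  calc _ ≤ (Q * (1 + ‖z‖) ^ N) * (Q * (1 + ‖z‖) ^ N) :=
        mul_le_mul h1 h2 (norm_nonneg _) ((norm_nonneg _).trans h1)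
    _ = _ := by ring

theorem exists_isXiZeroSequence : ∃ α : ℕ → ℂ, IsXiZeroSequence α := by
  classical
  have htop : ∀ z, analyticOrderAt Xi z ≠ ⊤ := by
    intro z hz
    have h1 : Set.EqOn Xi 0 Set.univ :=
      (differentiable_Xi.differentiableOn.analyticOnNhd isOpen_univ).eqOn_zero_of_preconnected_of_eventuallyEq_zero
        isPreconnected_univ (Set.mem_univ z) (analyticOrderAt_eq_top.1 hz)
    exact Xi_zero_ne_zero (h1 (Set.mem_univ 0))
  -- Each point is repeated as often as its order, which is finite as `Xi` is not identically zero;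
  -- non-zeros get an empty fibre.
  let I := Σ z : {z : ℂ // 0 < z.re}, Fin (analyticOrderNatAt Xi z)
  let v : I → ℂ := fun i => i.1
  have hpos : ∀ i, 0 < (v i).re := fun i => i.1.2
  have hv : ∀ z : ℂ, 0 < z.re → {i | v i = z}.encard = analyticOrderAt Xi z := by
    intro z hz
    have e : {i | v i = z} = Set.range (Sigma.mk (β := fun z : {z : ℂ // 0 < z.re} =>
        Fin (analyticOrderNatAt Xi z)) ⟨z, hz⟩) := by
      ext ⟨⟨w, hw⟩, k⟩
      constructor
      · intro h
        have h' : w = z := h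
        subst h'
        exact ⟨k, rfl⟩
      · rintro ⟨k', hk'⟩
        have := congrArg v hk'
        exact this.symm
    rw [e, ← Set.image_univ, sigma_mk_injective.encard_image, Set.encard_univ]
    simp [Nat.cast_analyticOrderNatAt (htop z)]
  have hall := encard_sumElim_eq hpos hv
  have hinf : Infinite I := by
    by_contra h
    rw [not_infinite_iff_finite] at h
    have := infinite_of_encard_eq hall
    exact not_finite (I ⊕ I)
  -- The zeros lie in |Im z| ≤ 1/2, so a bound on the real part bounds the norm, and zeros of
  -- bounded norm are finite in number.
  have hfin : ∀ R : ℝ, {i | (v i).re ≤ R}.Finite := by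
    intro R
    have h1 := finite_norm_le differentiable_Xi Xi_zero_ne_zero hall (by norm_num) (by norm_num)
      norm_Xi_le (R := |R| + 1) (by positivity)
    refine (h1.preimage Sum.inl_injective.injOn).subset fun i hi => ?_
    have hz : Xi (v i) = 0 := by
      apply apply_eq_zero_of_analyticOrderAt_ne_zero
      rw [← hv (v i) (hpos i), Ne, Set.encard_eq_zero]
      exact Set.Nonempty.ne_empty ⟨i, rfl⟩
    have h2 := abs_im_le_of_Xi_eq_zero hz
    have h3 := norm_le_abs_re_add_abs_im (v i)
    rw [abs_of_pos (hpos i)] at h3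
    have h4 : (v i).re ≤ R := hi
    change ‖v i‖ ≤ |R| + 1
    linarith [le_abs_self R]
  obtain ⟨e, he⟩ := exists_equiv_nat_monotone (fun i => (v i).re) hfin
  refine ⟨fun n => v (e n), fun n => hpos _, he, fun z hz => ?_⟩
  rw [← hv z hz, ← e.injective.encard_image]
  congr 1
  ext i
  constructor
  · rintro ⟨n, hn, rfl⟩
    exact hn
  · intro hi
    exact ⟨e.symm i, by simpa using hi, by simp⟩

/-! ### Logarithmic derivatives of `xi` and its factors at 1/2. -/

theorem deriv_logDeriv_eq {f : ℂ → ℂ} {x : ℂ} (hf : AnalyticAt ℂ f x) (hfx : f x ≠ 0) :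
    deriv (logDeriv f) x = deriv (deriv f) x / f x - (deriv f x / f x) ^ 2 := by
  have h := (hf.deriv.differentiableAt.hasDerivAt.div hf.differentiableAt.hasDerivAt hfx).deriv
  refine h.trans ?_
  field_simp

theorem xi_eventuallyEq : xi =ᶠ[𝓝 (1 / 2)] fun s =>
    s * (s - 1) / 2 * (Real.pi : ℂ) ^ (-s / 2) * Gamma (s / 2) * riemannZeta s := by
  filter_upwards [(isOpen_lt continuous_const continuous_re).mem_nhds
      (by norm_num : (0 : ℝ) < (1 / 2 : ℂ).re), (isOpen_lt continuous_re continuous_const).mem_nhds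
      (by norm_num : (1 / 2 : ℂ).re < (1 : ℝ))] with s h0 h1
  have h0' : 0 < s.re := h0
  refine xi_eq s ?_ ?_
  · rintro rfl
    simp at h1
  · rintro n rfl
    simp at h0'
    linarith [Nat.cast_nonneg (α := ℝ) n]

theorem xi_one_half_ne_zero : xi (1 / 2) ≠ 0 := by
  have := xi_ofReal_ne_zero (1 / 2)
  push_cast at this
  exact this

theorem riemannZeta_one_half_ne_zero : riemannZeta (1 / 2) ≠ 0 := by
  intro h
  apply xi_one_half_ne_zero
  rw [xi_eventuallyEq.eq_of_nhds, h, mul_zero]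

/-- The derivative of `xi` is odd about 1/2 by the functional equation. -/
theorem logDeriv_xi_one_half : logDeriv xi (1 / 2) = 0 := by
  have h1 : HasDerivAt (fun s => xi (1 - s)) (-deriv xi (1 - 1 / 2)) (1 / 2) :=
    (differentiable_xi _).hasDerivAt.comp_const_sub 1 (1 / 2)
  rw [funext xi_one_sub, show (1 : ℂ) - 1 / 2 = 1 / 2 by norm_num] at h1
  have h2 := h1.deriv
  have h3 : deriv xi (1 / 2) = 0 := self_eq_neg.1 h2
  rw [logDeriv_apply, h3, zero_div]

/-- The sign is I², from the chain rule for t ↦ 1/2 + It. -/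
theorem deriv_logDeriv_Xi_zero : deriv (logDeriv Xi) 0 = -deriv (logDeriv xi) (1 / 2) := by
  have hl : ∀ t : ℂ, HasDerivAt (fun t : ℂ => 1 / 2 + I * t) I t := fun t => by
    simpa using ((hasDerivAt_id t).const_mul I).const_add (1 / 2)
  have e : logDeriv Xi = fun t => logDeriv xi (1 / 2 + I * t) * I := by
    ext t
    have := logDeriv_comp (f := xi) (differentiable_xi _) (hl t).differentiableAt
    rw [(hl t).deriv] at this
    exact this
  have hd : DifferentiableAt ℂ (logDeriv xi) (1 / 2 + I * 0) := by
    rw [mul_zero, add_zero]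
    exact ((differentiable_xi.analyticAt _).deriv.div (differentiable_xi.analyticAt _)
      xi_one_half_ne_zero).differentiableAt
  have h := ((hd.hasDerivAt.comp (0 : ℂ) (hl 0)).mul_const I).deriv
  rw [e]
  refine h.trans ?_
  rw [mul_zero, add_zero, mul_assoc, I_mul_I, mul_neg_one]

theorem hasDerivAt_mul_sub_one_div_two (s : ℂ) :
    HasDerivAt (fun s : ℂ => s * (s - 1) / 2) (s - 1 / 2) s := by
  have := (((hasDerivAt_id s).mul ((hasDerivAt_id s).sub_const 1)).div_const 2)
  refine this.congr_deriv ?_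
  simp
  ring

theorem logDeriv_mul_sub_one_div_two : logDeriv (fun s : ℂ => s * (s - 1) / 2) (1 / 2) = 0 := by
  rw [logDeriv_apply, (hasDerivAt_mul_sub_one_div_two _).deriv, sub_self, zero_div]

theorem deriv_logDeriv_mul_sub_one_div_two :
    deriv (logDeriv (fun s : ℂ => s * (s - 1) / 2)) (1 / 2) = -8 := by
  have h1 : deriv (fun s : ℂ => s * (s - 1) / 2) = fun s => s - 1 / 2 :=
    funext fun s => (hasDerivAt_mul_sub_one_div_two s).deriv
  rw [deriv_logDeriv_eq (by fun_prop) (by norm_num), h1]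
  simp
  norm_num

theorem logDeriv_pi_cpow (s : ℂ) :
    logDeriv (fun s : ℂ => (Real.pi : ℂ) ^ (-s / 2)) s = -(Real.log Real.pi / 2) := by
  have hπ : (Real.pi : ℂ) ≠ 0 := by exact_mod_cast Real.pi_ne_zero
  have h := ((hasDerivAt_id s).neg.div_const 2).const_cpow (c := (Real.pi : ℂ)) (Or.inl hπ)
  have h' : HasDerivAt (fun s : ℂ => (Real.pi : ℂ) ^ (-s / 2))
      ((Real.pi : ℂ) ^ (-s / 2) * log Real.pi * (-1 / 2)) s := h
  have hne : (Real.pi : ℂ) ^ (-s / 2) ≠ 0 := by simp [cpow_eq_zero_iff, Real.pi_ne_zero]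
  rw [logDeriv_apply, h'.deriv, ofReal_log Real.pi_pos.le]
  field_simp

theorem deriv_logDeriv_pi_cpow (s : ℂ) :
    deriv (logDeriv (fun s : ℂ => (Real.pi : ℂ) ^ (-s / 2))) s = 0 := by
  rw [funext logDeriv_pi_cpow]
  simp

theorem logDeriv_Gamma_div_two {s : ℂ} (hs : 0 < s.re) :
    logDeriv (fun s => Gamma (s / 2)) s = digamma (s / 2) / 2 := by
  have h := logDeriv_comp (f := Gamma) (g := fun s : ℂ => s / 2) (x := s)
    (analyticAt_Gamma_of_re_pos (by simpa using hs)).differentiableAt (by fun_prop)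
  rw [((hasDerivAt_id' s).div_const 2).deriv] at h
  refine h.trans ?_
  rw [digamma_def]
  ring

theorem deriv_logDeriv_Gamma_div_two :
    deriv (logDeriv (fun s => Gamma (s / 2))) (1 / 2)
      = ((Real.pi ^ 2 / 4 + 2 * catalanConstant : ℝ) : ℂ) := by
  have hev : logDeriv (fun s => Gamma (s / 2)) =ᶠ[𝓝 (1 / 2)] fun s => digamma (s / 2) / 2 := by
    filter_upwards [(isOpen_lt continuous_const continuous_re).mem_nhds
      (by norm_num : (0 : ℝ) < (1 / 2 : ℂ).re)] with s hs using logDeriv_Gamma_div_two hs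
  have h4 : (1 / 2 / 2 : ℂ) = ((1 / 4 : ℝ) : ℂ) := by push_cast; norm_num
  have hd : HasDerivAt digamma (realTrigamma (1 / 4) : ℝ) (1 / 2 / 2 : ℂ) := by
    have := (analyticAt_digamma_of_re_pos (s := (1 / 4 : ℝ)) (by norm_num)).differentiableAt.hasDerivAt
    rw [deriv_digamma_ofReal (by norm_num)] at this
    rwa [h4]
  have h := ((hd.comp (1 / 2 : ℂ) ((hasDerivAt_id' (1 / 2 : ℂ)).div_const 2)).div_const 2).deriv
  rw [hev.deriv_eq]
  refine h.trans ?_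
  rw [realTrigamma_one_fourth]
  push_cast
  ring

theorem logDeriv_and_deriv_logDeriv_xi_one_half :
    logDeriv xi (1 / 2) = -(Real.log Real.pi / 2) + digamma (1 / 4) / 2
      + logDeriv riemannZeta (1 / 2) ∧
    deriv (logDeriv xi) (1 / 2) = -8 + ((Real.pi ^ 2 / 4 + 2 * catalanConstant : ℝ) : ℂ)
      + deriv (logDeriv riemannZeta) (1 / 2) := by
  have hne : (1 / 2 : ℂ) ≠ 1 := by norm_num
  have hre : (0 : ℝ) < (1 / 2 : ℂ).re := by norm_num
  have hre' : (0 : ℝ) < (1 / 2 / 2 : ℂ).re := by norm_num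
  have a1 : AnalyticAt ℂ (fun s : ℂ => s * (s - 1) / 2) (1 / 2) := by fun_prop
  have a2 : AnalyticAt ℂ (fun s : ℂ => (Real.pi : ℂ) ^ (-s / 2)) (1 / 2) := by
    have hπ : (Real.pi : ℂ) ≠ 0 := by exact_mod_cast Real.pi_ne_zero
    refine Differentiable.analyticAt (fun s => ?_) _
    exact (by fun_prop : DifferentiableAt ℂ (fun s : ℂ => -s / 2) s).const_cpow (Or.inl hπ)
  have a3 : AnalyticAt ℂ (fun s : ℂ => Gamma (s / 2)) (1 / 2) :=
    (analyticAt_Gamma_of_re_pos hre').comp (f := fun s : ℂ => s / 2) (by fun_prop)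
  have a4 : AnalyticAt ℂ riemannZeta (1 / 2) := analyticOn_riemannZeta _ hne
  have n1 : (1 / 2 : ℂ) * (1 / 2 - 1) / 2 ≠ 0 := by norm_num
  have n2 : (Real.pi : ℂ) ^ (-(1 / 2 : ℂ) / 2) ≠ 0 := by simp [cpow_eq_zero_iff, Real.pi_ne_zero]
  have n3 : Gamma (1 / 2 / 2) ≠ 0 := Gamma_ne_zero_of_re_pos hre'
  have n4 := riemannZeta_one_half_ne_zero
  have a12 : AnalyticAt ℂ (fun s : ℂ => s * (s - 1) / 2 * (Real.pi : ℂ) ^ (-s / 2)) (1 / 2) :=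
    a1.mul a2
  have a123 : AnalyticAt ℂ
      (fun s : ℂ => s * (s - 1) / 2 * (Real.pi : ℂ) ^ (-s / 2) * Gamma (s / 2)) (1 / 2) :=
    a12.mul a3
  have n12 := mul_ne_zero n1 n2
  have n123 := mul_ne_zero n12 n3
  have hl := logDeriv_congr_nhds xi_eventuallyEq
  constructor
  · have e1 := logDeriv_mul (1 / 2 : ℂ) n1 n2 a1.differentiableAt a2.differentiableAt
    have e2 := logDeriv_mul (1 / 2 : ℂ) n12 n3 a12.differentiableAt a3.differentiableAt
    have e3 := logDeriv_mul (1 / 2 : ℂ) n123 n4 a123.differentiableAt a4.differentiableAt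
    rw [hl.eq_of_nhds, e3, e2, e1, logDeriv_mul_sub_one_div_two, logDeriv_pi_cpow,
      logDeriv_Gamma_div_two hre, zero_add, show (1 / 2 / 2 : ℂ) = 1 / 4 by norm_num]
  · rw [hl.deriv_eq, deriv_logDeriv_mul a123 a4 n123 n4, deriv_logDeriv_mul a12 a3 n12 n3,
      deriv_logDeriv_mul a1 a2 n1 n2, deriv_logDeriv_mul_sub_one_div_two, deriv_logDeriv_pi_cpow,
      deriv_logDeriv_Gamma_div_two, add_zero]

/-- All zeros are the α together with the -α, and each pair contributes 2/α². In ℂ, `Summable`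
amounts to absolute convergence. -/
theorem summable_and_deriv_logDeriv_Xi {α : ℕ → ℂ} (hα : IsXiZeroSequence α) :
    Summable (fun n => 1 / α n ^ 2) ∧ deriv (logDeriv Xi) 0 = -(2 * ∑' n, 1 / α n ^ 2) := by
  obtain ⟨hs, he⟩ := summable_and_deriv_logDeriv_eq differentiable_Xi Xi_zero_ne_zero
    (encard_sumElim_eq hα.re_pos hα.multiplicity) (C := 20) (p := 3 / 2) (by norm_num)
    (by norm_num) (by norm_num) norm_Xi_le
  have h1 := hs.comp_injective Sum.inl_injective
  have h2 := hs.comp_injective Sum.inr_injective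
  refine ⟨h1, ?_⟩
  rw [he, Summable.tsum_sum h1 h2]
  simp only [Sum.elim_inl, Sum.elim_inr, Pi.neg_apply, even_two.neg_pow]
  ring

end

theorem mainTheorem1 :
    riemannZeta (1 / 2) ≠ 0 ∧
    deriv riemannZeta (1 / 2) / riemannZeta (1 / 2) =
      ((Real.pi / 4 + Real.eulerMascheroniConstant / 2 + Real.log (8 * Real.pi) / 2 : ℝ) : ℂ) ∧
    (∃ α : ℕ → ℂ, IsXiZeroSequence α) ∧
    ∀ α : ℕ → ℂ, IsXiZeroSequence α →
      Summable (fun n : ℕ => 1 / α n ^ 2) ∧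
      deriv (deriv riemannZeta) (1 / 2) / riemannZeta (1 / 2) -
          (deriv riemannZeta (1 / 2) / riemannZeta (1 / 2)) ^ 2 =
        ((8 - Real.pi ^ 2 / 4 - 2 * catalanConstant : ℝ) : ℂ) + 2 * ∑' n : ℕ, 1 / α n ^ 2 := by
  obtain ⟨h1, h2⟩ := logDeriv_and_deriv_logDeriv_xi_one_half
  refine ⟨riemannZeta_one_half_ne_zero, ?_, exists_isXiZeroSequence, fun α hα => ?_⟩
  · rw [logDeriv_xi_one_half, digamma_one_fourth, logDeriv_apply] at h1
    have hlog : Real.log (8 * Real.pi) = 3 * Real.log 2 + Real.log Real.pi := by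
      rw [Real.log_mul (by norm_num) Real.pi_ne_zero, show (8 : ℝ) = 2 ^ 3 by norm_num,
        Real.log_pow]
      norm_num
    rw [hlog]
    push_cast at h1 ⊢
    linear_combination -h1
  · obtain ⟨hs, he⟩ := summable_and_deriv_logDeriv_Xi hα
    refine ⟨hs, ?_⟩
    rw [← deriv_logDeriv_eq (analyticOn_riemannZeta _ (by norm_num : (1 / 2 : ℂ) ≠ 1))
      riemannZeta_one_half_ne_zero]
    rw [deriv_logDeriv_Xi_zero, h2] at he
    push_cast at he ⊢
    linear_combination -he
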